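/- Let $d\ge 2$. Let $\mathbb R^{d\times d}_{\rm sym}$ be the space of symmetric $d\times d$ matrices with the Frobenius norm $|\cdot|$, let $\mathbb S^{d-1}$ be the unit sphere of $\mathbb R^d$, and let $(a\odot b)_{ij}=\frac12(a_ib_j+a_jb_i)$. Fix a map $\mathbb S^{d-1}\ni\nu\mapsto R_\nu\in SO(d)$ such that $R_\nu e_d=\nu$, $R_\nu(Q(0,\rho))=R_{-\nu}(Q(0,\rho))$ for all $\rho>0$, $R_{e_d}=I$, and $\nu\mapsto R_\nu$ is continuous on each of the two sets of unit vectors whose last nonzero coordinate is positive, respectively negative; here $Q(x,\rho)=\{y:|(y-x)\cdot e_i|<\rho/2\ \forall i\}$. Set $Q_\nu(x,\rho)=x+R_\nu(Q(0,\rho))$ and $u_{x,\zeta,\nu}(y)=\zeta$ if $(y-x)\cdot\nu>0$, $u_{x,\zeta,\nu}(y)=0$ otherwise. Let $0<\alpha<1$, $0<c_1\le c_3$, $c_2,c_4,c_5,c_6,c_7\ge0$ and $\sigma_1>0$. Let $f\colon\mathbb R^d\times\mathbb R^{d\times d}_{\rm sym}\to[0,\infty)$ be Borel with, for all $x$, $A$,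 $A_1$, $A_2$ and $s,t>0$, $$c_1|A|-c_2\le f(x,A)\le c_3|A|+c_4,\qquad |f(x,A_1)-f(x,A_2)|\le c_5|A_1-A_2|,$$ $$\Big|\frac{f(x,sA)}s-\frac{f(x,tA)}t\Big|\le\frac{c_6}s f(x,sA)^{1-\alpha}+\frac{c_6}s+\frac{c_6}t f(x,tA)^{1-\alpha}+\frac{c_6}t .$$ Let $g\colon\mathbb R^d\times\mathbb R^d\times\mathbb S^{d-1}\to[0,\infty)$ be Borel with, for all $x$, $\zeta$, $\zeta_1$, $\zeta_2$, $\nu$ and $s,t>0$, $$g(x,\zeta,\nu)=g(x,-\zeta,-\nu),\quad c_1|\zeta\odot\nu|\le g(x,\zeta,\nu)\le c_3|\zeta\odot\nu|,\quad |g(x,\zeta_1,\nu)-g(x,\zeta_2,\nu)|\le\sigma_1|\zeta_1-\zeta_2|,$$ $$\Big|\frac{g(x,s\zeta,\nu)}s-\frac{g(x,t\zeta,\nu)}t\Big|\le c_7\Big(\frac{g(x,s\zeta,\nu)}s+\frac{g(x,t\zeta,\nu)}t\Big)\Big(\frac1s+\frac1t\Big).$$ Set $f^\infty(x,A)=\limsup_{t\to+\infty}f(x,tA)/t$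 and $g^\infty(x,\zeta,\nu)=\lim_{t\to+\infty}g(x,t\zeta,\nu)/t$ and, for $\varepsilon>0$, $f_\varepsilon(x,A)=f(x/\varepsilon,A)$ and $g_\varepsilon(x,\zeta,\nu)=\varepsilon\,g(x/\varepsilon,\zeta/\varepsilon,\nu)$. For a bounded open set $U$ and $u\in BD(U)$, with $Eu=\frac12(Du+Du^T)=\mathcal Eu\,\mathcal L^d+E^su$ (Lebesgue decomposition), jump set $J_u$, jump $[u]$, normal $\nu_u$, and Cantor part $E^cu=E^su$ restricted to $U\setminus J_u$, let $$F^{f,g}(u,U)=\int_U f(x,\mathcal Eu)\,dx+\int_U f^\infty\Big(x,\frac{dE^cu}{d|E^cu|}\Big)\,d|E^cu|+\int_{J_u\cap U}g(x,[u],\nu_u)\,d\mathcal H^{d-1},$$ and for $U$ a cube let $\mathfrak m^{F^{f,g}}(v,U)=\inf\{F^{f,g}(u,U):u\in BD(U),\ u=v\text{ on }\partial U\text{ in the sense of traces}\}$. Put $F_\varepsilon=F^{f_\varepsilon,g_\varepsilon}$ and $F^\infty=F^{f^\infty,g^\infty}$. Then for all $\varepsilon>0$ with $2c_6\varepsilon<1$,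 $x,\zeta\in\mathbb R^d$, $\nu\in\mathbb S^{d-1}$ and $\rho\in(0,1)$, the two infima below are finite and $$\Big|\mathfrak m^{F_\varepsilon}(u_{x,\zeta,\nu},Q_\nu(x,\rho))-\varepsilon^{d-1}\,\mathfrak m^{F^\infty}\big(u_{\frac x\varepsilon,\zeta,\nu},Q_\nu(\tfrac x\varepsilon,\tfrac\rho\varepsilon)\big)\Big|\le C\rho^{d-1+\alpha}+C\varepsilon\rho^{d-1},$$ where $C>0$ depends only on $|\zeta|,\alpha,c_3,c_6,c_7$. -/

import Mathlib

open MeasureTheory Filter Topology Set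
open scoped ENNReal NNReal RealInnerProductSpace ContDiff

noncomputable section

namespace BDCubes

/-- The Euclidean space of dimension `d`. -/
abbrev E (d : ℕ) : Type := EuclideanSpace ℝ (Fin d)

/-- The unit sphere of the Euclidean space. -/
abbrev Sph (d : ℕ) : Type := Metric.sphere (0 : E d) 1

/-! ### Symmetric matrices -/

/-- The subspace of symmetric matrices inside the space of all `d × d` matrices. A matrix is
written as a vector indexed by `Fin d × Fin d`, so that the Euclidean norm is the Frobenius norm. -/
def symSubmodule (d : ℕ) : Submodule ℝ (EuclideanSpace ℝ (Fin d × Fin d)) where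
  carrier := {A | ∀ i j, A (i, j) = A (j, i)}
  add_mem' := by
    intro A B hA hB i j
    simp [hA i j, hB i j]
  zero_mem' := by
    intro i j
    simp
  smul_mem' := by
    intro c A hA i j
    simp [hA i j]

/-- The space of symmetric `d × d` matrices, with the Frobenius norm. -/
abbrev SymMat (d : ℕ) : Type := symSubmodule d

variable {d : ℕ}

/-- The symmetric tensor product `(a ⊙ b)_{ij} = (a_i b_j + a_j b_i) / 2`. -/
def symProd (a b : E d) : SymMat d :=
  ⟨WithLp.toLp 2 fun p => (a p.1 * b p.2 + a p.2 * b p.1) / 2, by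
    intro i j
    simp [add_comm]⟩

/-- The `(i, j)` entry of a symmetric matrix, as a linear functional. -/
def entry (i j : Fin d) : SymMat d →L[ℝ] ℝ :=
  (EuclideanSpace.proj (𝕜 := ℝ) (i, j)).comp (symSubmodule d).subtypeL

/-! ### Vector measures with values in the symmetric matrices -/

/-- The `(i, j)` entry of a matrix-valued measure, a signed measure. -/
def entryMeasure (μ : VectorMeasure (E d) (SymMat d)) (i j : Fin d) : SignedMeasure (E d) :=
  μ.mapRange (entry i j : SymMat d →+ ℝ) (entry i j).continuous

/-- The Radon-Nikodym density of (the absolutely continuous part of) a matrix-valued measure `μ`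
with respect to a positive measure `l`, computed entry by entry: the matrix with entries
`dμ_{ij}/dl`, which is the sum of `dμ_{ij}/dl • (e_i ⊙ e_j)` over all `i, j`. -/
def density (μ : VectorMeasure (E d) (SymMat d)) (l : Measure (E d)) (x : E d) : SymMat d :=
  ∑ i, ∑ j, (entryMeasure μ i j).rnDeriv l x •
    symProd (EuclideanSpace.single i 1) (EuclideanSpace.single j 1)

/-! ### Functions of bounded deformation -/

/-- `μ` is the distributional symmetric gradient `Eu = (Du + Duᵀ)/2` of `u` on the open set `U`:
`∫_U u ⊙ ∇φ dx = - ∫_U φ dμ` for all test functions `φ` on `U`. A measure on `U` is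
identified with a measure on the whole space that vanishes off `U`. -/
structure IsSymGrad (U : Set (E d)) (u : E d → E d) (μ : VectorMeasure (E d) (SymMat d)) :
    Prop where
  supported : ∀ B, MeasurableSet B → μ B = μ (B ∩ U)
  integral_eq : ∀ φ : E d → ℝ, ContDiff ℝ ∞ φ → HasCompactSupport φ → tsupport φ ⊆ U →
    ∫ x in U, symProd (u x) (gradient φ x) = -∫ᵛ x, φ x ∂•μ

/-- `u ∈ BD(U)`. Only the values of `u` on `U` matter. -/
def BD (U : Set (E d)) (u : E d → E d) : Prop :=
  IntegrableOn u U ∧ ∃ μ : VectorMeasure (E d) (SymMat d), IsSymGrad U u μ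

open Classical in
/-- The measure `Eu` on `U` (zero if `u` has none). -/
def symGrad (U : Set (E d)) (u : E d → E d) : VectorMeasure (E d) (SymMat d) :=
  if h : ∃ μ : VectorMeasure (E d) (SymMat d), IsSymGrad U u μ then h.choose else 0

/-- `(u⁺, u⁻, ν)` is a triple of one-sided limits and normal for `u` at `x`. -/
def IsJump (u : E d → E d) (x : E d) (p : E d × E d × Sph d) : Prop :=
  p.1 ≠ p.2.1 ∧
  Tendsto (fun ρ : ℝ => (ENNReal.ofReal (ρ ^ d))⁻¹ *
    ∫⁻ y in Metric.ball x ρ ∩ {y | 0 < ⟪y - x, (p.2.2 : E d)⟫}, ‖u y - p.1‖ₑ)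
    (𝓝[>] 0) (𝓝 0) ∧
  Tendsto (fun ρ : ℝ => (ENNReal.ofReal (ρ ^ d))⁻¹ *
    ∫⁻ y in Metric.ball x ρ ∩ {y | ⟪y - x, (p.2.2 : E d)⟫ < 0}, ‖u y - p.2.1‖ₑ)
    (𝓝[>] 0) (𝓝 0)

/-- The jump set `J_u ∩ U`. -/
def jumpSet (U : Set (E d)) (u : E d → E d) : Set (E d) := {x | x ∈ U ∧ ∃ p, IsJump u x p}

open Classical in
/-- `g(x, [u](x), ν_u(x))` at a point `x` where `u` jumps (zero elsewhere). The triple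
`(u⁺, u⁻, ν_u)` is unique up to the exchange with `(u⁻, u⁺, -ν_u)`, so that for `g` with
`g(x, ζ, ν) = g(x, -ζ, -ν)` the value does not depend on the choice. -/
def jumpValue (g : E d → E d → Sph d → ℝ) (u : E d → E d) (x : E d) : ℝ :=
  if h : ∃ p, IsJump u x p then
    g x (h.choose.1 - h.choose.2.1) h.choose.2.2
  else 0

/-- The density `𝓔u` of the absolutely continuous part of `Eu`. -/
def acDensity (U : Set (E d)) (u : E d → E d) : E d → SymMat d := density (symGrad U u) volume

/-- The singular part `E^s u = Eu - 𝓔u dx`. -/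
def singularPart (U : Set (E d)) (u : E d → E d) : VectorMeasure (E d) (SymMat d) :=
  symGrad U u - (volume : Measure (E d)).withDensityᵥ (acDensity U u)

/-- The Cantor part `E^c u`, the restriction of `E^s u` to `U \ J_u`. -/
def cantorPart (U : Set (E d)) (u : E d → E d) : VectorMeasure (E d) (SymMat d) :=
  (singularPart U u).restrict (U \ jumpSet U u)

/-! ### Integrands and functionals -/

/-- The recession function `f^∞(x, A) = limsup_{t → ∞} f(x, tA)/t`. -/
def recession (f : E d → SymMat d → ℝ) (x : E d) (A : SymMat d) : ℝ :=
  limsup (fun t : ℝ => f x (t • A) / t) atTop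

/-- The limit `g^∞(x, ζ, ν) = lim_{t → ∞} g(x, tζ, ν)/t`. -/
def surfRecession (g : E d → E d → Sph d → ℝ) (x ζ : E d) (ν : Sph d) : ℝ :=
  limUnder atTop (fun t : ℝ => g x (t • ζ) ν / t)

/-- The functional `F^{f,g}(u, U)` for `U` open and `u ∈ BD(U)`: the sum of
`∫_U f(x, 𝓔u) dx`, of `∫_U f^∞(x, dE^c u/d|E^c u|) d|E^c u|`, and of
`∫_{J_u ∩ U} g(x, [u], ν_u) dH^{d-1}`. -/
def energy (f : E d → SymMat d → ℝ) (g : E d → E d → Sph d → ℝ) (u : E d → E d)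
    (U : Set (E d)) : ℝ≥0∞ :=
  (∫⁻ x in U, ENNReal.ofReal (f x (acDensity U u x))) +
  (∫⁻ x in U, ENNReal.ofReal
      (recession f x (density (cantorPart U u) (cantorPart U u).variation x))
    ∂(cantorPart U u).variation) +
  (∫⁻ x in jumpSet U u, ENNReal.ofReal (jumpValue g u x)
    ∂(Measure.euclideanHausdorffMeasure (d - 1) : Measure (E d)))

/-- The function `τ` is the trace of `u` on the boundary of `U`: for `H^{d-1}`-almost
every `x ∈ ∂U`, `ρ^{-d} ∫_{B_ρ(x) ∩ U} |u(y) - τ(x)| dy → 0` as `ρ → 0`. -/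
def HasTrace (U : Set (E d)) (u τ : E d → E d) : Prop :=
  ∀ᵐ x ∂((Measure.euclideanHausdorffMeasure (d - 1) : Measure (E d)).restrict (frontier U)),
    Tendsto (fun ρ : ℝ => (ENNReal.ofReal (ρ ^ d))⁻¹ *
      ∫⁻ y in Metric.ball x ρ ∩ U, ‖u y - τ x‖ₑ) (𝓝[>] 0) (𝓝 0)

/-- `u = v` on `∂U` in the sense of traces: the trace of `u - v` vanishes. -/
def EqOnBoundary (U : Set (E d)) (u v : E d → E d) : Prop :=
  HasTrace U (fun y => u y - v y) 0

/-- The infimum of `F^{f,g}(u, U)` over all `u ∈ BD(U)` with `u = v` on `∂U`. -/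
def minValue (f : E d → SymMat d → ℝ) (g : E d → E d → Sph d → ℝ) (v : E d → E d)
    (U : Set (E d)) : ℝ≥0∞ :=
  ⨅ (u : E d → E d) (_ : BD U u) (_ : EqOnBoundary U u v), energy f g u U

/-- The class of bulk integrands with growth constants `c₁, …, c₄` and Lipschitz constant `c₅`. -/
structure IsBulk (c₁ c₂ c₃ c₄ c₅ : ℝ) (f : E d → SymMat d → ℝ) : Prop where
  nonneg : ∀ x A, 0 ≤ f x A
  measurable : Measurable fun p : E d × SymMat d => f p.1 p.2
  lower : ∀ x A, c₁ * ‖A‖ - c₂ ≤ f x A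
  upper : ∀ x A, f x A ≤ c₃ * ‖A‖ + c₄
  lipschitz : ∀ x A₁ A₂, |f x A₁ - f x A₂| ≤ c₅ * ‖A₁ - A₂‖

/-- The subclass of bulk integrands whose recession function is attained at a prescribed rate. -/
structure IsBulkAlpha (c₁ c₂ c₃ c₄ c₅ c₆ α : ℝ) (f : E d → SymMat d → ℝ) : Prop
    extends IsBulk c₁ c₂ c₃ c₄ c₅ f where
  rate : ∀ x A, ∀ s t : ℝ, 0 < s → 0 < t →
    |f x (s • A) / s - f x (t • A) / t| ≤
      c₆ / s * f x (s • A) ^ (1 - α) + c₆ / s + c₆ / t * f x (t • A) ^ (1 - α) + c₆ / t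

/-- The class of surface integrands with growth constants `c₁, c₃` and modulus of continuity `σ`. -/
structure IsSurf (c₁ c₃ : ℝ) (σ : ℝ → ℝ) (g : E d → E d → Sph d → ℝ) : Prop where
  nonneg : ∀ x ζ ν, 0 ≤ g x ζ ν
  measurable : Measurable fun p : E d × E d × Sph d => g p.1 p.2.1 p.2.2
  symm : ∀ x ζ ν, g x ζ ν = g x (-ζ) (-ν)
  lower : ∀ x ζ (ν : Sph d), c₁ * ‖symProd ζ (ν : E d)‖ ≤ g x ζ ν
  upper : ∀ x ζ (ν : Sph d), g x ζ ν ≤ c₃ * ‖symProd ζ (ν : E d)‖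
  modulus : ∀ x ζ₁ ζ₂ ν, |g x ζ₁ ν - g x ζ₂ ν| ≤ σ ‖ζ₁ - ζ₂‖

/-- The subclass of surface integrands whose limit `g^∞` is attained at a prescribed rate. -/
structure IsSurfInfty (c₁ c₃ c₇ : ℝ) (σ : ℝ → ℝ) (g : E d → E d → Sph d → ℝ) : Prop
    extends IsSurf c₁ c₃ σ g where
  rate : ∀ x ζ ν, ∀ s t : ℝ, 0 < s → 0 < t →
    |g x (s • ζ) ν / s - g x (t • ζ) ν / t| ≤
      c₇ * (g x (s • ζ) ν / s + g x (t • ζ) ν / t) * (1 / s + 1 / t)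

/-- The rescaled bulk integrand `f_ε(x, A) = f(x/ε, A)`. -/
def scaledBulk (ε : ℝ) (f : E d → SymMat d → ℝ) : E d → SymMat d → ℝ :=
  fun x A => f (ε⁻¹ • x) A

/-- The rescaled surface integrand `g_ε(x, ζ, ν) = ε g(x/ε, ζ/ε, ν)`. -/
def scaledSurf (ε : ℝ) (g : E d → E d → Sph d → ℝ) : E d → E d → Sph d → ℝ :=
  fun x ζ ν => ε * g (ε⁻¹ • x) (ε⁻¹ • ζ) ν

/-! ### Rotated cubes and jump functions -/

/-- The open cube with centre `x`, side length `ρ` and sides parallel to the axes. -/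
def cube (x : E d) (ρ : ℝ) : Set (E d) := {y | ∀ i, |(y - x) i| < ρ / 2}

/-- The action of a rotation on the Euclidean space. -/
def rot (A : Matrix.specialOrthogonalGroup (Fin d) ℝ) (y : E d) : E d :=
  Matrix.toEuclideanCLM (𝕜 := ℝ) (A : Matrix (Fin d) (Fin d) ℝ) y

/-- The unit vectors whose last nonzero coordinate is positive. -/
def upperHalf (d : ℕ) : Set (Sph d) :=
  {ν | ∃ i, 0 < (ν : E d) i ∧ ∀ j, i < j → (ν : E d) j = 0}

/-- The unit vectors whose last nonzero coordinate is negative. -/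
def lowerHalf (d : ℕ) : Set (Sph d) :=
  {ν | ∃ i, (ν : E d) i < 0 ∧ ∀ j, i < j → (ν : E d) j = 0}

/-- A choice of rotations `ν ↦ R_ν` with `R_ν e_d = ν`, `R_ν Q(0, ρ) = R_{-ν} Q(0, ρ)`,
`R_{e_d} = I`, and continuous on each of the two halves of the sphere. The vector `e_d` is
`EuclideanSpace.single i 1` for the last index `i`, the one with `i + 1 = d`. -/
structure IsFrame (R : Sph d → Matrix.specialOrthogonalGroup (Fin d) ℝ) : Prop where
  map_last : ∀ (ν : Sph d) (i : Fin d), (i : ℕ) + 1 = d →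
    rot (R ν) (EuclideanSpace.single i 1) = ν
  cube_neg : ∀ (ν : Sph d) (ρ : ℝ), 0 < ρ → rot (R ν) '' cube 0 ρ = rot (R (-ν)) '' cube 0 ρ
  eq_one : ∀ (ν : Sph d) (i : Fin d), (i : ℕ) + 1 = d →
    (ν : E d) = EuclideanSpace.single i 1 → R ν = 1
  continuousOn_upper : ContinuousOn R (upperHalf d)
  continuousOn_lower : ContinuousOn R (lowerHalf d)

/-- The open cube `Q_ν(x, ρ) = x + R_ν Q(0, ρ)`. -/
def rotCube (R : Sph d → Matrix.specialOrthogonalGroup (Fin d) ℝ) (ν : Sph d) (x : E d)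
    (ρ : ℝ) : Set (E d) :=
  (fun y => x + rot (R ν) y) '' cube 0 ρ

open Classical in
/-- The function `u_{x,ζ,ν}`, equal to `ζ` where `(y - x) · ν > 0` and to `0` elsewhere. -/
def jumpFun (x ζ : E d) (ν : Sph d) (y : E d) : E d :=
  if 0 < ⟪y - x, (ν : E d)⟫ then ζ else 0

end BDCubes

end

open BDCubes

noncomputable section

namespace BDCubes

section

variable {d : ℕ}

/-! ### Limits attained at a rate -/

/-! The two functionals are compared on the same cube and with the same competitors, so everything
rests on pointwise comparisons of integrands. Letting one parameter tend to infinity in the rate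
conditions gives `|f - f^∞| ≤ c₆ f^(1-α) + c₆` and `|g_ε - g^∞| ≤ c₇ ε (g_ε + g^∞)`. The sublinear
power is linearised at the scale of the cube by `t^(1-α) ≤ ρ^α t + ρ^(α-1)` (`rpow_one_sub_le`). For
small rates each of `f`, `f^∞` is then at most `1 + 2 c₆ ρ^α` times the other plus `4 c₆ ρ^(α-1)`,
and each of `g_ε`, `g^∞` is at most `1 + 4 c₇ ε` times the other. Since `f` and `f^∞` have the same
recession function, the Cantor terms agree. The comparison passes to energies and infima
(`minValue_scaled_le_and_ge`); the additive error, integrated over a cube of volume `ρ^d`, is of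
order `ρ^(d-1+α)`.

The relative error is harmless because both infima are at most a constant times `ρ^(d-1)`: the jump
function itself is a competitor (`minValue_jumpFun_le`). Its symmetric gradient is computed by the
divergence theorem on a half-space and identified by uniqueness (`isSymGrad_jumpFun`,
`IsSymGrad.symGrad_eq`). It has no absolutely continuous and no Cantor part, and the jump set lies
in the middle section of the cube. The bulk term only sees `f x 0`, which is bounded in terms of `α`
and `c₆` alone (`exists_bulk_zero_le`), so the constant does not involve `c₄`.

Finally `f^∞` is positively 1-homogeneous, so a dilation by `1/ε` multiplies the limit energy by
`ε^(-(d-1))` (`minValue_dilation`). If the rates are not small, the trivial bound of order `ρ^(d-1)`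
is absorbed by the right-hand side (`abs_sub_le_of_rates`). -/

lemma exists_tendsto_of_rate {h e : ℝ → ℝ} (he : Tendsto e atTop (𝓝 0))
    (H : ∀ s t, 0 < s → 0 < t → |h s - h t| ≤ e s + e t) :
    ∃ L, Tendsto h atTop (𝓝 L) ∧ ∀ s, 0 < s → |h s - L| ≤ e s := by
  have hc : Cauchy (map h atTop) := by
    rw [Metric.cauchy_iff]
    refine ⟨inferInstance, fun η hη => ?_⟩
    have h1 : ∀ᶠ t in atTop, e t < η / 2 ∧ 0 < t :=
      (he.eventually (gt_mem_nhds (half_pos hη))).and (eventually_gt_atTop 0)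
    obtain ⟨N, hN⟩ := eventually_atTop.1 h1
    refine ⟨h '' Ici N, image_mem_map (Ici_mem_atTop N), ?_⟩
    rintro _ ⟨s, hs, rfl⟩ _ ⟨t, ht, rfl⟩
    rw [Real.dist_eq]
    have := H s t (hN s hs).2 (hN t ht).2
    linarith [(hN s hs).1, (hN t ht).1]
  obtain ⟨L, hL⟩ := CompleteSpace.complete hc
  refine ⟨L, hL, fun s hs => ?_⟩
  have hL' : Tendsto h atTop (𝓝 L) := hL
  have h1 : Tendsto (fun t => |h s - h t|) atTop (𝓝 |h s - L|) :=
    (tendsto_const_nhds.sub hL').abs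
  have h2 : Tendsto (fun t => e s + e t) atTop (𝓝 (e s + 0)) := tendsto_const_nhds.add he
  rw [add_zero] at h2
  exact le_of_tendsto_of_tendsto h1 h2
    ((eventually_gt_atTop 0).mono fun t ht => H s t hs ht)

/-- Split at `t = 1/ρ`: below it `t^(1-α)` is at most `ρ^(α-1)`, above it `t^(-α)` is at most `ρ^α`.
In the application `ρ` is the side of the cube. -/
lemma rpow_one_sub_le {t ρ α : ℝ} (ht : 0 ≤ t) (hρ : 0 < ρ) (hα₀ : 0 < α) (hα₁ : α < 1) :
    t ^ (1 - α) ≤ ρ ^ α * t + ρ ^ (α - 1) := by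
  have hρα : 0 < ρ ^ α := Real.rpow_pos_of_pos hρ _
  have hρα' : 0 < ρ ^ (α - 1) := Real.rpow_pos_of_pos hρ _
  rcases le_or_gt t ρ⁻¹ with h | h
  · have h1 : t ^ (1 - α) ≤ (ρ⁻¹) ^ (1 - α) := Real.rpow_le_rpow ht h (by linarith)
    rw [Real.inv_rpow hρ.le, ← Real.rpow_neg hρ.le, neg_sub] at h1
    nlinarith [mul_nonneg hρα.le ht]
  · have ht' : 0 < t := (inv_pos.2 hρ).trans h
    have h1 : t ^ (1 - α) = t * (t⁻¹) ^ α := by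
      rw [Real.inv_rpow ht, ← Real.rpow_neg ht, sub_eq_add_neg, Real.rpow_add ht',
        Real.rpow_one]
    have h2 : (t⁻¹) ^ α ≤ ρ ^ α :=
      Real.rpow_le_rpow (by positivity) (inv_le_of_inv_le₀ hρ h.le) hα₀.le
    rw [h1]
    nlinarith

/-! ### Bulk integrands -/

section Bulk

variable {c₁ c₂ c₃ c₄ c₅ c₆ α : ℝ} {f : E d → SymMat d → ℝ}

lemma IsBulk.tendsto_rate (hf : IsBulk c₁ c₂ c₃ c₄ c₅ f) (hα₀ : 0 < α) (hα₁ : α < 1)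
    (hc₃ : 0 ≤ c₃) (hc₄ : 0 ≤ c₄) (x : E d) (A : SymMat d) :
    Tendsto (fun t : ℝ => c₆ / t * f x (t • A) ^ (1 - α) + c₆ / t) atTop (𝓝 0) := by
  have h0 : Tendsto (fun t : ℝ => c₆ / t) atTop (𝓝 0) := tendsto_const_nhds.div_atTop tendsto_id
  have hM : 0 ≤ c₃ * ‖A‖ + c₄ := by positivity
  have h1 : Tendsto (fun t : ℝ => (c₃ * ‖A‖ + c₄) ^ (1 - α) * t ^ (-α)) atTop (𝓝 0) := by
    simpa using (tendsto_rpow_neg_atTop hα₀).const_mul ((c₃ * ‖A‖ + c₄) ^ (1 - α))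
  have h2 : Tendsto (fun t : ℝ => f x (t • A) ^ (1 - α) / t) atTop (𝓝 0) := by
    refine squeeze_zero' ?_ ?_ h1
    · filter_upwards [eventually_gt_atTop 0] with t ht
      exact div_nonneg (Real.rpow_nonneg (hf.nonneg _ _) _) ht.le
    -- For `t ≥ 1` the growth bound is linear in `t`, so the quotient decays like `t^(-α)`.
    · filter_upwards [eventually_ge_atTop 1] with t ht
      have ht0 : 0 < t := by linarith
      have h3 : f x (t • A) ≤ (c₃ * ‖A‖ + c₄) * t := by
        refine (hf.upper x _).trans ?_
        rw [norm_smul, Real.norm_of_nonneg ht0.le]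
        nlinarith
      rw [div_le_iff₀ ht0]
      refine (Real.rpow_le_rpow (hf.nonneg _ _) h3 (by linarith)).trans_eq ?_
      rw [Real.mul_rpow hM ht0.le, mul_assoc, ← Real.rpow_add_one ht0.ne']
      ring_nf
  have h4 := (h2.const_mul c₆).add h0
  simp only [mul_zero, add_zero] at h4
  refine h4.congr fun t => ?_
  ring

lemma IsBulkAlpha.exists_limit (hf : IsBulkAlpha c₁ c₂ c₃ c₄ c₅ c₆ α f) (hα₀ : 0 < α)
    (hα₁ : α < 1) (hc₃ : 0 ≤ c₃) (hc₄ : 0 ≤ c₄) (x : E d) (A : SymMat d) :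
    Tendsto (fun t : ℝ => f x (t • A) / t) atTop (𝓝 (recession f x A)) ∧
      ∀ s : ℝ, 0 < s →
        |f x (s • A) / s - recession f x A| ≤ c₆ / s * f x (s • A) ^ (1 - α) + c₆ / s := by
  obtain ⟨L, hL, hL'⟩ := exists_tendsto_of_rate
    (hf.toIsBulk.tendsto_rate (c₆ := c₆) hα₀ hα₁ hc₃ hc₄ x A)
    (h := fun t : ℝ => f x (t • A) / t) (fun s t hs ht => by
      refine (hf.rate x A s t hs ht).trans_eq ?_
      ring)
  have h : recession f x A = L := hL.limsup_eq
  rw [h]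
  exact ⟨hL, hL'⟩

lemma IsBulkAlpha.abs_sub_recession_le (hf : IsBulkAlpha c₁ c₂ c₃ c₄ c₅ c₆ α f) (hα₀ : 0 < α)
    (hα₁ : α < 1) (hc₃ : 0 ≤ c₃) (hc₄ : 0 ≤ c₄) (x : E d) (A : SymMat d) :
    |f x A - recession f x A| ≤ c₆ * f x A ^ (1 - α) + c₆ := by
  simpa using (hf.exists_limit hα₀ hα₁ hc₃ hc₄ x A).2 1 one_pos

lemma IsBulkAlpha.recession_nonneg (hf : IsBulkAlpha c₁ c₂ c₃ c₄ c₅ c₆ α f) (hα₀ : 0 < α)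
    (hα₁ : α < 1) (hc₃ : 0 ≤ c₃) (hc₄ : 0 ≤ c₄) (x : E d) (A : SymMat d) :
    0 ≤ recession f x A :=
  ge_of_tendsto (hf.exists_limit hα₀ hα₁ hc₃ hc₄ x A).1
    ((eventually_gt_atTop 0).mono fun _ ht => div_nonneg (hf.nonneg _ _) ht.le)

lemma IsBulkAlpha.recession_smul (hf : IsBulkAlpha c₁ c₂ c₃ c₄ c₅ c₆ α f) (hα₀ : 0 < α)
    (hα₁ : α < 1) (hc₃ : 0 ≤ c₃) (hc₄ : 0 ≤ c₄) (x : E d) (A : SymMat d) {s : ℝ} (hs : 0 < s) :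
    recession f x (s • A) = s * recession f x A := by
  have h1 := (hf.exists_limit hα₀ hα₁ hc₃ hc₄ x (s • A)).1
  have h2 := (((hf.exists_limit hα₀ hα₁ hc₃ hc₄ x A).1.comp
    (tendsto_id.atTop_mul_const hs)).const_mul s)
  refine tendsto_nhds_unique h1 (h2.congr' ?_)
  filter_upwards [eventually_gt_atTop 0] with t ht
  simp only [Function.comp, id, smul_smul]
  field_simp

lemma IsBulkAlpha.recession_zero (hf : IsBulkAlpha c₁ c₂ c₃ c₄ c₅ c₆ α f) (hα₀ : 0 < α)
    (hα₁ : α < 1) (hc₃ : 0 ≤ c₃) (hc₄ : 0 ≤ c₄) (x : E d) : recession f x 0 = 0 := by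
  have := hf.recession_smul hα₀ hα₁ hc₃ hc₄ x 0 (s := 2) (by norm_num)
  rw [smul_zero] at this
  linarith

/-- This gives `(f^∞)^∞ = f^∞`, so the functional with bulk integrand `f^∞` has the same Cantor term
as the original one. -/
lemma recession_eq_of_smul {h : E d → SymMat d → ℝ}
    (hh : ∀ x A (s : ℝ), 0 < s → h x (s • A) = s * h x A) : recession h = h := by
  funext x A
  have : Tendsto (fun t : ℝ => h x (t • A) / t) atTop (𝓝 (h x A)) := by
    refine tendsto_const_nhds.congr' ?_
    filter_upwards [eventually_gt_atTop 0] with t ht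
    rw [hh x A t ht]
    field_simp
  exact this.limsup_eq

/-- With `k = c₆ ρ^α` and `b = c₆ ρ^(α-1) ≥ c₆`, the rate gives `(1 - k) f ≤ f^∞ + 2b`. The term in
`f` is absorbed using `(1 + 2k)(1 - k) ≥ 1` for `k ≤ 1/2`, and `(1 + 2k) 2b ≤ 4b`. -/
lemma IsBulkAlpha.bulk_le (hf : IsBulkAlpha c₁ c₂ c₃ c₄ c₅ c₆ α f) (hα₀ : 0 < α)
    (hα₁ : α < 1) (hc₃ : 0 ≤ c₃) (hc₄ : 0 ≤ c₄) (hc₆ : 0 ≤ c₆) {ρ : ℝ} (hρ : 0 < ρ) (hρ₁ : ρ ≤ 1)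
    (hcρ : 2 * (c₆ * ρ ^ α) ≤ 1) (x : E d) (A : SymMat d) :
    f x A ≤ (1 + 2 * (c₆ * ρ ^ α)) * recession f x A + 4 * c₆ * ρ ^ (α - 1) := by
  have h1 := (abs_le.1 (hf.abs_sub_recession_le hα₀ hα₁ hc₃ hc₄ x A)).2
  have h2 := mul_le_mul_of_nonneg_left
    (rpow_one_sub_le (hf.nonneg x A) hρ hα₀ hα₁) hc₆
  have h3 : 1 ≤ ρ ^ (α - 1) := Real.one_le_rpow_of_pos_of_le_one_of_nonpos hρ hρ₁ (by linarith)
  have h4 := hf.recession_nonneg hα₀ hα₁ hc₃ hc₄ x A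
  have h5 := hf.nonneg x A
  set k := c₆ * ρ ^ α with hk
  have hk0 : 0 ≤ k := by positivity
  set b := c₆ * ρ ^ (α - 1) with hb
  have hb0 : c₆ ≤ b := by nlinarith
  have h6 : (1 - k) * f x A ≤ recession f x A + 2 * b := by nlinarith
  have h7 : (1 + 2 * k) * ((1 - k) * f x A) ≤ (1 + 2 * k) * (recession f x A + 2 * b) :=
    mul_le_mul_of_nonneg_left h6 (by linarith)
  have h8 : f x A ≤ (1 + 2 * k) * ((1 - k) * f x A) := by
    nlinarith [mul_nonneg (mul_nonneg hk0 (by linarith : 0 ≤ 1 - 2 * k)) h5]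
  nlinarith

/-- Here the power of `f` is already on the larger side, so nothing is absorbed and no smallness is
needed; the constants are those of `bulk_le` for symmetry. -/
lemma IsBulkAlpha.recession_le (hf : IsBulkAlpha c₁ c₂ c₃ c₄ c₅ c₆ α f) (hα₀ : 0 < α)
    (hα₁ : α < 1) (hc₃ : 0 ≤ c₃) (hc₄ : 0 ≤ c₄) (hc₆ : 0 ≤ c₆) {ρ : ℝ} (hρ : 0 < ρ) (hρ₁ : ρ ≤ 1)
    (x : E d) (A : SymMat d) :
    recession f x A ≤ (1 + 2 * (c₆ * ρ ^ α)) * f x A + 4 * c₆ * ρ ^ (α - 1) := by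
  have h1 := (abs_le.1 (hf.abs_sub_recession_le hα₀ hα₁ hc₃ hc₄ x A)).1
  have h2 := mul_le_mul_of_nonneg_left
    (rpow_one_sub_le (hf.nonneg x A) hρ hα₀ hα₁) hc₆
  have h3 : 1 ≤ ρ ^ (α - 1) := Real.one_le_rpow_of_pos_of_le_one_of_nonpos hρ hρ₁ (by linarith)
  have h5 := hf.nonneg x A
  have h6 : 0 ≤ ρ ^ α := Real.rpow_nonneg hρ.le _
  have h7 : 0 ≤ c₆ * ρ ^ α * f x A := by positivity
  nlinarith

end Bulk

/-- Since `f^∞ x 0 = 0`, the rate bounds `f x 0` by a sublinear function of itself. Applying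
`bulk_le` at a scale `σ` with `2 c₆ σ^α ≤ 1` makes this explicit. -/
lemma exists_bulk_zero_le (α c₆ : ℝ) (hα₀ : 0 < α) (hα₁ : α < 1) (hc₆ : 0 ≤ c₆) :
    ∃ K : ℝ, 0 ≤ K ∧ ∀ (d : ℕ) (c₁ c₂ c₃ c₄ c₅ : ℝ), 0 ≤ c₃ → 0 ≤ c₄ →
      ∀ f : E d → SymMat d → ℝ, IsBulkAlpha c₁ c₂ c₃ c₄ c₅ c₆ α f → ∀ x, f x 0 ≤ K := by
  set σ : ℝ := (1 / (2 * c₆ + 1)) ^ (1 / α) with hσ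
  have h0 : 0 < 2 * c₆ + 1 := by positivity
  have hσ0 : 0 < σ := Real.rpow_pos_of_pos (by positivity) _
  have hσ1 : σ ≤ 1 := Real.rpow_le_one (by positivity)
    (by rw [div_le_one h0]; linarith) (by positivity)
  have hσα : σ ^ α = 1 / (2 * c₆ + 1) := by
    rw [hσ, ← Real.rpow_mul (by positivity), one_div_mul_cancel hα₀.ne', Real.rpow_one]
  refine ⟨4 * c₆ * σ ^ (α - 1), by positivity, ?_⟩
  intro d c₁ c₂ c₃ c₄ c₅ hc₃ hc₄ f hf x
  have h := hf.bulk_le hα₀ hα₁ hc₃ hc₄ hc₆ hσ0 hσ1 (by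
    rw [hσα, mul_one_div, ← mul_div_assoc, div_le_one h0]
    linarith) x 0
  rwa [hf.recession_zero hα₀ hα₁ hc₃ hc₄, mul_zero, zero_add] at h

/-! ### Surface integrands -/

/-- The matrix `a ⊙ b` is the average of `a ⊗ b` and `b ⊗ a`, each of Frobenius norm `‖a‖ * ‖b‖`. -/
lemma norm_symProd_le (a b : E d) : ‖symProd a b‖ ≤ ‖a‖ * ‖b‖ := by
  have key : ∀ a b : E d, ‖(WithLp.toLp 2 fun p : Fin d × Fin d => a p.1 * b p.2 :
      EuclideanSpace ℝ (Fin d × Fin d))‖ = ‖a‖ * ‖b‖ := by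
    intro a b
    rw [EuclideanSpace.norm_eq, EuclideanSpace.norm_eq, EuclideanSpace.norm_eq,
      ← Real.sqrt_mul (by positivity), Finset.sum_mul_sum, Fintype.sum_prod_type]
    congr 1
    refine Finset.sum_congr rfl fun i _ => Finset.sum_congr rfl fun j _ => ?_
    simp [mul_pow]
  have h : (symProd a b : EuclideanSpace ℝ (Fin d × Fin d)) = (1 / 2 : ℝ) •
      ((WithLp.toLp 2 fun p : Fin d × Fin d => a p.1 * b p.2 :
        EuclideanSpace ℝ (Fin d × Fin d)) +
      (WithLp.toLp 2 fun p : Fin d × Fin d => b p.1 * a p.2)) := by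
    ext p
    simp [symProd]
    ring
  change ‖(symProd a b : EuclideanSpace ℝ (Fin d × Fin d))‖ ≤ _
  rw [h, norm_smul]
  have := norm_add_le (WithLp.toLp 2 fun p : Fin d × Fin d => a p.1 * b p.2 :
        EuclideanSpace ℝ (Fin d × Fin d)) (WithLp.toLp 2 fun p : Fin d × Fin d => b p.1 * a p.2)
  rw [key, key] at this
  norm_num
  linarith [mul_comm ‖a‖ ‖b‖]

section Surf

variable {c₁ c₃ c₇ : ℝ} {σ : ℝ → ℝ} {g : E d → E d → Sph d → ℝ}

lemma IsSurf.le_norm (hg : IsSurf c₁ c₃ σ g) (hc₃ : 0 ≤ c₃) (x ζ : E d) (ν : Sph d) :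
    g x ζ ν ≤ c₃ * ‖ζ‖ := by
  refine (hg.upper x ζ ν).trans (mul_le_mul_of_nonneg_left ?_ hc₃)
  simpa [norm_eq_of_mem_sphere ν] using norm_symProd_le ζ (ν : E d)

lemma IsSurf.smul_div_le (hg : IsSurf c₁ c₃ σ g) (hc₃ : 0 ≤ c₃) (x ζ : E d) (ν : Sph d) {t : ℝ}
    (ht : 0 < t) : g x (t • ζ) ν / t ≤ c₃ * ‖ζ‖ := by
  rw [div_le_iff₀ ht]
  refine (hg.le_norm hc₃ x _ ν).trans_eq ?_
  rw [norm_smul, Real.norm_of_nonneg ht.le]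
  ring

lemma IsSurfInfty.tendsto (hg : IsSurfInfty c₁ c₃ c₇ σ g) (hc₃ : 0 ≤ c₃) (hc₇ : 0 ≤ c₇)
    (x ζ : E d) (ν : Sph d) :
    Tendsto (fun t : ℝ => g x (t • ζ) ν / t) atTop (𝓝 (surfRecession g x ζ ν)) := by
  have h0 : Tendsto (fun t : ℝ => 2 * c₇ * (c₃ * ‖ζ‖) / t) atTop (𝓝 0) :=
    tendsto_const_nhds.div_atTop tendsto_id
  obtain ⟨L, hL, -⟩ := exists_tendsto_of_rate h0
    (h := fun t : ℝ => g x (t • ζ) ν / t) (fun s t hs ht => by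
      refine (hg.rate x ζ ν s t hs ht).trans ?_
      have h1 := hg.toIsSurf.smul_div_le hc₃ x ζ ν hs
      have h2 := hg.toIsSurf.smul_div_le hc₃ x ζ ν ht
      have h3 : c₇ * (g x (s • ζ) ν / s + g x (t • ζ) ν / t) ≤ c₇ * (2 * (c₃ * ‖ζ‖)) :=
        mul_le_mul_of_nonneg_left (by linarith) hc₇
      refine (mul_le_mul_of_nonneg_right h3 (by positivity)).trans_eq ?_
      ring)
  have : surfRecession g x ζ ν = L := hL.limUnder_eq
  rwa [this]

lemma IsSurfInfty.surfRecession_nonneg (hg : IsSurfInfty c₁ c₃ c₇ σ g) (hc₃ : 0 ≤ c₃)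
    (hc₇ : 0 ≤ c₇) (x ζ : E d) (ν : Sph d) : 0 ≤ surfRecession g x ζ ν :=
  ge_of_tendsto (hg.tendsto hc₃ hc₇ x ζ ν)
    ((eventually_gt_atTop 0).mono fun _ ht => div_nonneg (hg.nonneg _ _ _) ht.le)

lemma IsSurfInfty.surfRecession_le (hg : IsSurfInfty c₁ c₃ c₇ σ g) (hc₃ : 0 ≤ c₃)
    (hc₇ : 0 ≤ c₇) (x ζ : E d) (ν : Sph d) : surfRecession g x ζ ν ≤ c₃ * ‖ζ‖ :=
  le_of_tendsto (hg.tendsto hc₃ hc₇ x ζ ν)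
    ((eventually_gt_atTop 0).mono fun _ ht => hg.toIsSurf.smul_div_le hc₃ x ζ ν ht)

/-- This is the rate condition with `s = 1/ε` and `t → ∞`. -/
lemma IsSurfInfty.abs_sub_surfRecession_le (hg : IsSurfInfty c₁ c₃ c₇ σ g) (hc₃ : 0 ≤ c₃)
    (hc₇ : 0 ≤ c₇) (x ζ : E d) (ν : Sph d) {ε : ℝ} (hε : 0 < ε) :
    |ε * g x (ε⁻¹ • ζ) ν - surfRecession g x ζ ν| ≤
      c₇ * ε * (ε * g x (ε⁻¹ • ζ) ν + surfRecession g x ζ ν) := by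
  have hT := hg.tendsto hc₃ hc₇ x ζ ν
  have h0 : Tendsto (fun t : ℝ => 1 / t) atTop (𝓝 0) := tendsto_const_nhds.div_atTop tendsto_id
  have h1 := (tendsto_const_nhds (x := ε * g x (ε⁻¹ • ζ) ν)).sub hT |>.abs
  have h2 := (((tendsto_const_nhds (x := ε * g x (ε⁻¹ • ζ) ν)).add hT).const_mul c₇).mul
    ((tendsto_const_nhds (x := ε)).add h0)
  rw [add_zero] at h2
  refine (le_of_tendsto_of_tendsto h1 h2 ?_).trans_eq (by ring)
  filter_upwards [eventually_gt_atTop 0] with t ht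
  have := hg.rate x ζ ν ε⁻¹ t (inv_pos.2 hε) ht
  simpa only [div_inv_eq_mul, one_div, inv_inv, mul_comm _ ε, mul_one] using this

/-- For `k ≤ 1/2` one has `1 + k ≤ (1 - k)(1 + 4k)`. -/
lemma le_of_abs_sub_le {a b k : ℝ} (hb : 0 ≤ b) (hk : 0 ≤ k) (hk₁ : 2 * k ≤ 1)
    (h : |a - b| ≤ k * (a + b)) : a ≤ (1 + 4 * k) * b := by
  have h1 := (abs_le.1 h).2
  have h2 : (1 - k) * a ≤ (1 + k) * b := by linarith
  have h3 : (1 - k) * a ≤ (1 - k) * ((1 + 4 * k) * b) := by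
    nlinarith [mul_nonneg (mul_nonneg hk (by linarith : 0 ≤ 1 - 2 * k)) hb]
  exact le_of_mul_le_mul_left h3 (by linarith)

end Surf

end

section

variable {d : ℕ}

/-! ### Matrix-valued measures -/

@[simp] lemma entry_apply (i j : Fin d) (A : SymMat d) : entry i j A = (A : EuclideanSpace ℝ _) (i, j) :=
  rfl

lemma entryMeasure_apply (μ : VectorMeasure (E d) (SymMat d)) (i j : Fin d) (B : Set (E d)) :
    entryMeasure μ i j B = entry i j (μ B) := rfl

lemma norm_le_sum_entry (A : SymMat d) : ‖A‖ ≤ ∑ i, ∑ j, ‖entry i j A‖ := by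
  have h : (A : EuclideanSpace ℝ (Fin d × Fin d)) =
      ∑ p : Fin d × Fin d, EuclideanSpace.single p (entry p.1 p.2 A) := by
    ext q
    simp [Finset.sum_apply, Pi.single_apply]
  change ‖(A : EuclideanSpace ℝ (Fin d × Fin d))‖ ≤ _
  rw [h, ← Fintype.sum_prod_type' (f := fun i j => ‖entry i j A‖)]
  refine (norm_sum_le _ _).trans_eq ?_
  simp

/-- In finite dimension the variation is dominated by the sum of the total variations of the
entries, which are finite signed measures. -/
instance isFiniteMeasure_variation (μ : VectorMeasure (E d) (SymMat d)) :
    IsFiniteMeasure μ.variation := by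
  have h : μ.variation ≤ ∑ i, ∑ j, (entryMeasure μ i j).totalVariation := by
    refine VectorMeasure.variation_le_of_forall_enorm_le fun B _ => ?_
    simp only [Measure.coe_finsetSum, Finset.sum_apply]
    calc ‖μ B‖ₑ ≤ ∑ i, ∑ j, ‖entry i j (μ B)‖ₑ := by
          rw [← ofReal_norm]
          refine (ENNReal.ofReal_le_ofReal (norm_le_sum_entry _)).trans_eq ?_
          rw [ENNReal.ofReal_sum_of_nonneg fun _ _ => Finset.sum_nonneg fun _ _ => norm_nonneg _]
          refine Finset.sum_congr rfl fun i _ => ?_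
          rw [ENNReal.ofReal_sum_of_nonneg fun _ _ => norm_nonneg _]
          exact Finset.sum_congr rfl fun j _ => ofReal_norm _
      _ ≤ _ := Finset.sum_le_sum fun i _ => Finset.sum_le_sum fun j _ =>
          SignedMeasure.enorm_le_totalVariation (entryMeasure μ i j) B
  exact isFiniteMeasure_of_le _ h

lemma integrable_of_continuous_hasCompactSupport {V : Type*} [NormedAddCommGroup V]
    {μ : VectorMeasure (E d) V} (_ : IsFiniteMeasure μ.variation)
    {φ : E d → ℝ} (hφ : Continuous φ) (hc : HasCompactSupport φ) : μ.Integrable φ :=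
  hφ.integrable_of_hasCompactSupport hc

section VectorMeasure

variable {V : Type*} [NormedAddCommGroup V] [NormedSpace ℝ V] [CompleteSpace V]
  {μ : VectorMeasure (E d) V}

/-- A vector measure on an open set is determined by its action on test functions. -/
lemma vectorMeasure_eq_zero (_ : IsFiniteMeasure μ.variation) {U : Set (E d)} (hU : IsOpen U)
    (hμ : ∀ B, MeasurableSet B → μ B = μ (B ∩ U))
    (h : ∀ φ : E d → ℝ, ContDiff ℝ ∞ φ → HasCompactSupport φ → tsupport φ ⊆ U →
      ∫ᵛ x, φ x ∂•μ = 0) : μ = 0 := by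
  -- Choose an open `W ⊇ K` with `|μ|(W \ K) ≤ η` and a bump function `φ`, equal to 1 on `K` and
  -- supported in `W ∩ U`. As `φ` integrates to zero, `μ K` is the integral of `1_K - φ`, which is
  -- bounded by `|μ|(W \ K)`.
  have hK : ∀ K : Set (E d), IsCompact K → K ⊆ U → μ K = 0 := by
    intro K hK hKU
    rw [← norm_eq_zero]
    refine le_antisymm (le_of_forall_pos_le_add fun η hη => ?_) (norm_nonneg _)
    obtain ⟨W, hKW, hW, hWη⟩ := K.exists_isOpen_lt_add (μ := μ.variation)
      (measure_ne_top _ _) (ENNReal.ofReal_pos.2 hη).ne'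
    obtain ⟨V, hV, hKV, hVW, hVc⟩ := exists_open_between_and_isCompact_closure hK
      (hW.inter hU) (subset_inter hKW hKU)
    obtain ⟨φ, hφ, hφr, hφs, hφ1⟩ := exists_contMDiff_support_eq_eq_one_iff
      (modelWithCornersSelf ℝ (E d)) (n := ⊤) hV hK.isClosed hKV
    have hφd : ContDiff ℝ ∞ φ := hφ.contDiff
    have hts : tsupport φ = closure V := by rw [tsupport, hφs]
    have hφc : HasCompactSupport φ := by rw [HasCompactSupport, hts]; exact hVc
    have h0 := h φ hφd hφc (by rw [hts]; exact hVW.trans inter_subset_right)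
    have hi : μ.Integrable φ := hφd.continuous.integrable_of_hasCompactSupport hφc
    have hi' : μ.Integrable (K.indicator fun _ : E d => (1 : ℝ)) :=
      (integrable_const (1 : ℝ)).indicator hK.measurableSet
    have h1 := VectorMeasure.integral_indicator_const (μ := μ)
      (B := ContinuousLinearMap.lsmul ℝ ℝ) (1 : ℝ) hK.measurableSet
    simp only [ContinuousLinearMap.lsmul_apply, one_smul] at h1
    have h2 : μ K = ∫ᵛ x, (K.indicator (fun _ : E d => (1 : ℝ)) x - φ x) ∂•μ := by
      rw [VectorMeasure.integral_fun_sub hi' hi, h0, sub_zero, h1]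
    have h3 : ‖μ K‖ₑ ≤ ENNReal.ofReal η := by
      rw [h2]
      refine VectorMeasure.enorm_integral_le_lintegral_enorm_transpose.trans ?_
      rw [VectorMeasure.variation_transpose_lsmul]
      have h4 : ∀ x, ‖K.indicator (fun _ : E d => (1 : ℝ)) x - φ x‖ₑ ≤
          (W \ K).indicator 1 x := by
        intro x
        have hx01 := hφr (mem_range_self x)
        by_cases hxK : x ∈ K
        · simp [hxK, (hφ1 x).1 hxK]
        · by_cases hxW : x ∈ W
          · have : x ∈ W \ K := ⟨hxW, hxK⟩
            simp only [hxK, not_false_eq_true, indicator_of_notMem, this, indicator_of_mem,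
              Pi.one_apply, zero_sub, enorm_neg]
            rw [Real.enorm_of_nonneg hx01.1]
            exact ENNReal.ofReal_le_one.2 hx01.2
          · have hx0 : φ x = 0 := by
              by_contra hne
              have : x ∈ V := hφs ▸ (Function.mem_support.2 hne)
              exact hxW (hVW (subset_closure this)).1
            simp [hxK, hx0]
      refine (lintegral_mono h4).trans ?_
      rw [lintegral_indicator_one (hW.measurableSet.diff hK.measurableSet),
        measure_sdiff hKW hK.measurableSet.nullMeasurableSet (measure_ne_top _ _)]
      exact tsub_le_iff_left.2 hWη.le
    rw [← ofReal_norm, ENNReal.ofReal_le_ofReal_iff hη.le] at h3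
    linarith
  -- Inner regularity of the variation extends the vanishing from compact sets to Borel sets.
  ext1 B hB
  rw [hμ B hB, _root_.zero_apply, ← norm_eq_zero]
  refine le_antisymm (le_of_forall_pos_le_add fun η hη => ?_) (norm_nonneg _)
  have hBU : MeasurableSet (B ∩ U) := hB.inter hU.measurableSet
  obtain ⟨K, hKB, hKc, hKη⟩ := hBU.exists_isCompact_sdiff_lt (μ := μ.variation)
    (measure_ne_top _ _) (ENNReal.ofReal_pos.2 hη).ne'
  have h1 : μ (B ∩ U) = μ ((B ∩ U) \ K) := by
    rw [← VectorMeasure.of_add_of_sdiff hKc.measurableSet hBU hKB,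
      hK K hKc (hKB.trans inter_subset_right), zero_add]
  have h2 := (μ.enorm_measure_le_variation ((B ∩ U) \ K)).trans hKη.le
  rw [← h1, ← ofReal_norm, ENNReal.ofReal_le_ofReal_iff hη.le] at h2
  linarith

/-- A measure of the form `m A`, with `A` a constant vector, integrates as `m` does. -/
lemma integral_of_forall_eq_smul (_ : IsFiniteMeasure μ.variation) {A : V}
    (h : ∀ B, MeasurableSet B → μ B = μ.variation.real B • A) {φ : E d → ℝ}
    (hφ : μ.Integrable φ) : ∫ᵛ x, φ x ∂•μ = (∫ x, φ x ∂μ.variation) • A := by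
  refine Integrable.induction (fun φ => ∫ᵛ x, φ x ∂•μ = (∫ x, φ x ∂μ.variation) • A)
    (fun c s hs _ => ?_) (fun f g _ hf hg hf' hg' => ?_) ?_ (fun f g hfg _ hf' => ?_) hφ
  · rw [VectorMeasure.integral_indicator_const _ hs, integral_indicator_const _ hs, h _ hs]
    simp [smul_smul, mul_comm]
  · rw [VectorMeasure.integral_add hf hg, integral_add' hf hg, hf', hg', add_smul]
  · exact isClosed_eq VectorMeasure.continuous_integral
      (continuous_integral.smul continuous_const)
  · rw [← VectorMeasure.integral_congr_ae hfg, hf', integral_congr_ae hfg]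

end VectorMeasure

lemma IsSymGrad.unique {U : Set (E d)} (hU : IsOpen U) {u : E d → E d}
    {μ μ' : VectorMeasure (E d) (SymMat d)} (h : IsSymGrad U u μ) (h' : IsSymGrad U u μ') :
    μ = μ' := by
  rw [← sub_eq_zero]
  refine vectorMeasure_eq_zero (isFiniteMeasure_variation _) hU (fun B hB => ?_) fun φ hφ hc hs => ?_
  · rw [_root_.sub_apply, _root_.sub_apply, h.supported B hB, h'.supported B hB]
  · rw [VectorMeasure.integral_sub_vectorMeasure
      (integrable_of_continuous_hasCompactSupport (isFiniteMeasure_variation _) hφ.continuous hc)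
      (integrable_of_continuous_hasCompactSupport (isFiniteMeasure_variation _) hφ.continuous hc), sub_eq_zero,
      ← neg_inj, ← h.integral_eq φ hφ hc hs, ← h'.integral_eq φ hφ hc hs]

/-- `symGrad` is obtained by choice; uniqueness lets an explicit candidate replace it, for dilated
functions and for jump functions. -/
lemma IsSymGrad.symGrad_eq {U : Set (E d)} (hU : IsOpen U) {u : E d → E d}
    {μ : VectorMeasure (E d) (SymMat d)} (h : IsSymGrad U u μ) : symGrad U u = μ := by
  have h' : ∃ μ : VectorMeasure (E d) (SymMat d), IsSymGrad U u μ := ⟨μ, h⟩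
  rw [symGrad, dif_pos h']
  exact h'.choose_spec.unique hU h

lemma BD.isSymGrad {U : Set (E d)} {u : E d → E d} (h : BD U u) :
    IsSymGrad U u (symGrad U u) := by
  rw [symGrad, dif_pos h.2]
  exact h.2.choose_spec

end

section

variable {d : ℕ}

/-! ### Densities under a change of variables -/

/-- Pushing the Lebesgue decomposition of `s` forward gives a decomposition of the image into a
singular part and a density; uniqueness of the decomposition identifies the latter. -/
lemma rnDeriv_smul_map {X : Type*} [MeasurableSpace X] (s : SignedMeasure X) (l l' : Measure X)
    [SigmaFinite l] (e : X ≃ᵐ X) {a b : ℝ} (hb : 0 < b) (hl' : l' = ENNReal.ofReal b • l.map e) :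
    ∀ᵐ x ∂l, SignedMeasure.rnDeriv (a • s.map e) l' (e x) = a / b * s.rnDeriv l x := by
  have hb' : ENNReal.ofReal b ≠ 0 := (ENNReal.ofReal_pos.2 hb).ne'
  have hint : Integrable (fun y => a / b * s.rnDeriv l (e.symm y)) l' := by
    rw [hl']
    refine Integrable.smul_measure ?_ ENNReal.ofReal_ne_top
    rw [e.measurableEmbedding.integrable_map_iff]
    simpa [Function.comp_def] using (s.integrable_rnDeriv l).const_mul (a / b)
  have hsing : (a • (s.singularPart l).map e) ⟂ᵥ l'.toENNRealVectorMeasure := by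
    obtain ⟨S, hS, h1, h2⟩ := s.mutuallySingular_singularPart l
    refine VectorMeasure.MutuallySingular.mk (e.symm ⁻¹' S) (e.symm.measurable hS) ?_ ?_
    · intro t ht htm
      rw [_root_.smul_apply, VectorMeasure.map_apply _ e.measurable htm, h1, smul_zero]
      intro x hx
      simpa using ht hx
    · intro t ht htm
      rw [Measure.toENNRealVectorMeasure_apply_measurable htm, hl', Measure.smul_apply,
        Measure.map_apply e.measurable htm,
        ← Measure.toENNRealVectorMeasure_apply_measurable (e.measurable htm), h2, smul_zero]
      intro x hx
      simpa using ht hx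
  have hadd : a • s.map e = a • (s.singularPart l).map e +
      l'.withDensityᵥ (fun y => a / b * s.rnDeriv l (e.symm y)) := by
    ext B hB
    rw [_root_.add_apply, _root_.smul_apply, _root_.smul_apply,
      VectorMeasure.map_apply _ e.measurable hB, VectorMeasure.map_apply _ e.measurable hB,
      withDensityᵥ_apply hint hB, hl', Measure.restrict_smul, integral_smul_measure,
      setIntegral_map_equiv]
    conv_lhs => rw [← s.singularPart_add_withDensity_rnDeriv_eq l]
    rw [_root_.add_apply, withDensityᵥ_apply (s.integrable_rnDeriv l) (e.measurable hB)]
    simp only [MeasurableEquiv.symm_apply_apply, integral_const_mul, smul_eq_mul,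
      ENNReal.toReal_ofReal hb.le]
    field_simp
  have h := SignedMeasure.eq_rnDeriv _ _ hint hsing hadd
  rw [Filter.EventuallyEq, hl', Measure.ae_ennreal_smul_measure_iff hb',
    e.measurableEmbedding.ae_map_iff] at h
  filter_upwards [h] with x hx
  rw [hl', ← hx, MeasurableEquiv.symm_apply_apply]

lemma entryMeasure_smul_map (μ : VectorMeasure (E d) (SymMat d)) (e : E d ≃ᵐ E d) (a : ℝ)
    (i j : Fin d) : entryMeasure (a • μ.map e) i j = a • (entryMeasure μ i j).map e := by
  ext B hB
  rw [entryMeasure_apply, _root_.smul_apply, _root_.smul_apply,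
    VectorMeasure.map_apply _ e.measurable hB, VectorMeasure.map_apply _ e.measurable hB,
    entryMeasure_apply, map_smul]

lemma density_smul_map (μ : VectorMeasure (E d) (SymMat d)) (l l' : Measure (E d))
    [SigmaFinite l] (e : E d ≃ᵐ E d) {a b : ℝ} (hb : 0 < b)
    (hl' : l' = ENNReal.ofReal b • l.map e) :
    ∀ᵐ x ∂l, density (a • μ.map e) l' (e x) = (a / b) • density μ l x := by
  have h : ∀ᵐ x ∂l, ∀ i j, SignedMeasure.rnDeriv (entryMeasure (a • μ.map e) i j) l' (e x) =
      a / b * (entryMeasure μ i j).rnDeriv l x := by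
    rw [ae_all_iff]
    intro i
    rw [ae_all_iff]
    intro j
    rw [entryMeasure_smul_map]
    exact rnDeriv_smul_map _ l l' e hb hl'
  filter_upwards [h] with x hx
  simp only [density, hx, mul_smul, Finset.smul_sum]

lemma integrable_density (μ : VectorMeasure (E d) (SymMat d)) (l : Measure (E d)) :
    Integrable (density μ l) l :=
  integrable_finsetSum _ fun i _ => integrable_finsetSum _ fun j _ =>
    ((entryMeasure μ i j).integrable_rnDeriv l).smul_const _

end

section

variable {d : ℕ}

/-! ### Dilations -/

/-- The dilation `y ↦ t y`. -/
def dilation (t : ℝ) (ht : 0 < t) : E d ≃ᵐ E d := MeasurableEquiv.smul₀ t ht.ne'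

variable {t : ℝ} (ht : 0 < t)

@[simp] lemma dilation_apply (y : E d) : dilation t ht y = t • y := rfl

@[simp] lemma dilation_symm_apply (y : E d) : (dilation t ht).symm y = t⁻¹ • y := rfl

lemma symProd_smul_right (s : ℝ) (a b : E d) : symProd a (s • b) = s • symProd a b := by
  ext p
  simp [symProd]
  ring

lemma volume_eq_smul_map_dilation :
    (volume : Measure (E d)) = ENNReal.ofReal (t ^ d) • volume.map (dilation t ht) := by
  have h := Measure.map_addHaar_smul (volume : Measure (E d)) ht.ne'
  rw [finrank_euclideanSpace_fin, abs_of_pos (by positivity)] at h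
  change volume = _ • Measure.map (t • ·) volume
  rw [h, smul_smul, ← ENNReal.ofReal_mul (by positivity), mul_inv_cancel₀ (by positivity),
    ENNReal.ofReal_one, one_smul]

open scoped Pointwise in
lemma euclideanHausdorffMeasure_eq_smul_map_dilation (k : ℕ) :
    (Measure.euclideanHausdorffMeasure k : Measure (E d)) =
      ENNReal.ofReal (t ^ k) • (Measure.euclideanHausdorffMeasure k).map (dilation t ht) := by
  ext B hB
  have h : B = t • ((dilation t ht) ⁻¹' B) := by
    ext y
    rw [mem_smul_set_iff_inv_smul_mem₀ ht.ne']
    simp [ht.ne']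
  rw [Measure.smul_apply, Measure.map_apply (dilation t ht).measurable hB]
  conv_lhs => rw [h, Measure.euclideanHausdorffMeasure_smul₀ k ht.ne']
  rw [ENNReal.ofReal_pow ht.le, ← Real.enorm_of_nonneg ht.le, enorm_eq_nnnorm,
    ← ENNReal.coe_pow]
  rfl

lemma setLIntegral_smul_map {X : Type*} [MeasurableSpace X] (e : X ≃ᵐ X) (c : ℝ≥0∞)
    {m m' : Measure X} (h : m' = c • m.map e) (S : Set X) (F : X → ℝ≥0∞) :
    ∫⁻ z in e.symm ⁻¹' S, F z ∂m' = c * ∫⁻ y in S, F (e y) ∂m := by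
  have hS : e ⁻¹' (e.symm ⁻¹' S) = S := by
    ext y
    simp
  rw [h, Measure.restrict_smul, lintegral_smul_measure, e.restrict_map, lintegral_map_equiv, hS,
    smul_eq_mul]

lemma setIntegral_dilation {F : Type*} [NormedAddCommGroup F] [NormedSpace ℝ F] (S : Set (E d))
    (f : E d → F) :
    ∫ z in (dilation t ht).symm ⁻¹' S, f z = t ^ d • ∫ y in S, f (t • y) := by
  have hS : dilation t ht ⁻¹' ((dilation t ht).symm ⁻¹' S) = S := by
    ext y
    simp [ht.ne']
  conv_lhs => rw [volume_eq_smul_map_dilation ht]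
  rw [Measure.restrict_smul, integral_smul_measure, MeasurableEquiv.restrict_map, hS,
    integral_map_equiv, ENNReal.toReal_ofReal (by positivity)]
  rfl

lemma isOpen_dilation {U : Set (E d)} (hU : IsOpen U) :
    IsOpen ((dilation t ht).symm ⁻¹' U) :=
  hU.preimage (continuous_const_smul t⁻¹)

lemma gradient_comp_smul (φ : E d → ℝ) (s : ℝ) (y : E d) :
    gradient (fun y => φ (s • y)) y = s • gradient φ (s • y) := by
  rw [gradient, gradient, ← map_smul, ← fderiv_comp_smul]

/-- Test against `φ (t • ·)`: the volume contributes `t^d` and the gradient of the test function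
takes back one factor `t`. -/
lemma IsSymGrad.comp_dilation {U : Set (E d)} {u : E d → E d}
    {μ : VectorMeasure (E d) (SymMat d)} (hU : IsOpen U) (h : IsSymGrad U u μ) (hd : 1 ≤ d) :
    IsSymGrad ((dilation t ht).symm ⁻¹' U) (u ∘ (dilation t ht).symm)
      (t ^ (d - 1) • μ.map (dilation t ht)) where
  supported B hB := by
    have hBU : MeasurableSet (B ∩ (dilation t ht).symm ⁻¹' U) :=
      hB.inter ((dilation t ht).symm.measurable hU.measurableSet)
    have hpre : dilation t ht ⁻¹' (B ∩ (dilation t ht).symm ⁻¹' U) = dilation t ht ⁻¹' B ∩ U := by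
      ext y
      simp [ht.ne']
    rw [_root_.smul_apply, _root_.smul_apply, VectorMeasure.map_apply _ (dilation t ht).measurable hB,
      VectorMeasure.map_apply _ (dilation t ht).measurable hBU, hpre,
      h.supported _ ((dilation t ht).measurable hB)]
  integral_eq φ hφ hc hs := by
    have hts : tsupport (fun y => φ (t • y)) = (fun y => t • y) ⁻¹' tsupport φ :=
      tsupport_comp_eq_preimage φ (Homeomorph.smulOfNeZero t ht.ne')
    have h1 := h.integral_eq (fun y => φ (t • y)) (hφ.comp (contDiff_const_smul t))
      (hc.comp_homeomorph (Homeomorph.smulOfNeZero t ht.ne')) (by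
        rw [hts]
        intro y hy
        simpa [ht.ne'] using hs hy)
    rw [setIntegral_dilation, VectorMeasure.integral_smul_vectorMeasure,
      VectorMeasure.integral_map_equiv]
    simp only [gradient_comp_smul, symProd_smul_right, integral_smul, Function.comp,
      dilation_symm_apply, dilation_apply, inv_smul_smul₀ ht.ne'] at h1 ⊢
    rw [← smul_neg, ← h1, smul_smul, ← pow_succ, Nat.sub_add_cancel hd]

lemma BD.comp_dilation {U : Set (E d)} (hU : IsOpen U) {u : E d → E d} (h : BD U u)
    (hd : 1 ≤ d) : BD ((dilation t ht).symm ⁻¹' U) (u ∘ (dilation t ht).symm) := by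
  refine ⟨?_, _, h.isSymGrad.comp_dilation ht hU hd⟩
  have hS : dilation t ht ⁻¹' ((dilation t ht).symm ⁻¹' U) = U := by
    ext y
    simp [ht.ne']
  rw [volume_eq_smul_map_dilation ht, IntegrableOn, Measure.restrict_smul]
  refine Integrable.smul_measure ?_ ENNReal.ofReal_ne_top
  rw [← IntegrableOn, (dilation t ht).measurableEmbedding.integrableOn_map_iff, hS]
  simpa [Function.comp_def, ht.ne'] using h.1

lemma symGrad_dilation {U : Set (E d)} (hU : IsOpen U) {u : E d → E d} (h : BD U u)
    (hd : 1 ≤ d) : symGrad ((dilation t ht).symm ⁻¹' U) (u ∘ (dilation t ht).symm) =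
      t ^ (d - 1) • (symGrad U u).map (dilation t ht) :=
  (h.isSymGrad.comp_dilation ht hU hd).symGrad_eq (isOpen_dilation ht hU)

lemma acDensity_dilation {U : Set (E d)} (hU : IsOpen U) {u : E d → E d} (h : BD U u)
    (hd : 1 ≤ d) : ∀ᵐ y, acDensity ((dilation t ht).symm ⁻¹' U) (u ∘ (dilation t ht).symm) (t • y) =
      t⁻¹ • acDensity U u y := by
  have h1 := density_smul_map (symGrad U u) volume volume (dilation t ht) (a := t ^ (d - 1))
    (by positivity) (volume_eq_smul_map_dilation ht)
  filter_upwards [h1] with y hy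
  rw [acDensity, symGrad_dilation ht hU h hd]
  rw [dilation_apply] at hy
  rw [hy, acDensity]
  congr 1
  have : t ^ d = t ^ (d - 1) * t := by rw [← pow_succ, Nat.sub_add_cancel hd]
  rw [this]
  field_simp

lemma singularPart_dilation {U : Set (E d)} (hU : IsOpen U) {u : E d → E d} (h : BD U u)
    (hd : 1 ≤ d) : singularPart ((dilation t ht).symm ⁻¹' U) (u ∘ (dilation t ht).symm) =
      t ^ (d - 1) • (singularPart U u).map (dilation t ht) := by
  have hI : ∀ (U : Set (E d)) u, Integrable (acDensity U u) := fun U u => integrable_density _ _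
  ext1 B hB
  rw [singularPart, _root_.sub_apply, _root_.smul_apply,
    VectorMeasure.map_apply _ (dilation t ht).measurable hB, singularPart, _root_.sub_apply,
    withDensityᵥ_apply (hI _ _) hB,
    withDensityᵥ_apply (hI _ _) ((dilation t ht).measurable hB),
    symGrad_dilation ht hU h hd, _root_.smul_apply,
    VectorMeasure.map_apply _ (dilation t ht).measurable hB, smul_sub]
  congr 1
  have hB' : B = (dilation t ht).symm ⁻¹' (dilation t ht ⁻¹' B) := by
    ext y
    simp
  conv_lhs => rw [hB']
  rw [setIntegral_dilation, setIntegral_congr_ae (g := fun y => t⁻¹ • acDensity U u y)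
    ((dilation t ht).measurable hB)
    ((acDensity_dilation ht hU h hd).mono fun y hy _ => hy), integral_smul, smul_smul]
  congr 1
  have : t ^ d = t ^ (d - 1) * t := by rw [← pow_succ, Nat.sub_add_cancel hd]
  rw [this]
  field_simp

end

/-! ### Jump points, traces, energies and minimum values under dilations -/

section

variable {d : ℕ} {t : ℝ} (ht : 0 < t)

/-- Radius `ρ` after the dilation corresponds to radius `ρ/t` before it, and the factors `t^d`
cancel. Jump points and traces are both defined by means of this form. -/
lemma tendsto_mean_dilation (x : E d) (S : Set (E d)) (w : E d → E d)
    (h : Tendsto (fun ρ : ℝ => (ENNReal.ofReal (ρ ^ d))⁻¹ *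
      ∫⁻ y in Metric.ball x ρ ∩ S, ‖w y‖ₑ) (𝓝[>] 0) (𝓝 0)) :
    Tendsto (fun ρ : ℝ => (ENNReal.ofReal (ρ ^ d))⁻¹ *
      ∫⁻ z in Metric.ball (t • x) ρ ∩ (dilation t ht).symm ⁻¹' S, ‖w ((dilation t ht).symm z)‖ₑ)
      (𝓝[>] 0) (𝓝 0) := by
  have h1 : Tendsto (fun ρ : ℝ => t⁻¹ * ρ) (𝓝[>] 0) (𝓝[>] 0) := by
    refine tendsto_nhdsWithin_iff.2 ⟨?_, ?_⟩
    · have : Tendsto (fun ρ : ℝ => t⁻¹ * ρ) (𝓝 0) (𝓝 (t⁻¹ * 0)) := tendsto_id.const_mul _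
      rw [mul_zero] at this
      exact this.mono_left nhdsWithin_le_nhds
    · filter_upwards [self_mem_nhdsWithin] with ρ hρ
      exact mul_pos (inv_pos.2 ht) hρ
  refine (h.comp h1).congr' ?_
  filter_upwards [self_mem_nhdsWithin] with ρ hρ
  have hρ' : 0 < ρ := hρ
  have hball : Metric.ball (t • x) ρ ∩ (dilation t ht).symm ⁻¹' S =
      (dilation t ht).symm ⁻¹' (Metric.ball x (t⁻¹ * ρ) ∩ S) := by
    ext z
    have : dist z (t • x) = t * dist (t⁻¹ • z) x := by
      conv_lhs => rw [← smul_inv_smul₀ ht.ne' z, dist_smul₀, Real.norm_of_nonneg ht.le]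
    simp only [mem_inter_iff, Metric.mem_ball, mem_preimage, dilation_symm_apply, this]
    rw [lt_inv_mul_iff₀ ht]
  rw [hball, setLIntegral_smul_map _ _ (volume_eq_smul_map_dilation ht), ← mul_assoc,
    Function.comp]
  simp only [MeasurableEquiv.symm_apply_apply]
  congr 1
  rw [mul_pow, ENNReal.ofReal_mul (by positivity), ENNReal.mul_inv
    (Or.inl (ENNReal.ofReal_pos.2 (by positivity)).ne') (Or.inl ENNReal.ofReal_ne_top), inv_pow,
    ENNReal.ofReal_inv_of_pos (by positivity), inv_inv, mul_comm]

lemma IsJump.comp_dilation {u : E d → E d} {x : E d} {p : E d × E d × Sph d}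
    (h : IsJump u x p) : IsJump (u ∘ (dilation t ht).symm) (t • x) p := by
  have key : ∀ z : E d, ⟪t⁻¹ • z - x, (p.2.2 : E d)⟫ = t⁻¹ * ⟪z - t • x, (p.2.2 : E d)⟫ := by
    intro z
    rw [← real_inner_smul_left, smul_sub, inv_smul_smul₀ ht.ne']
  have h1 := tendsto_mean_dilation ht x _ _ h.2.1
  have h2 := tendsto_mean_dilation ht x _ _ h.2.2
  have hS1 : (dilation t ht).symm ⁻¹' {y | 0 < ⟪y - x, (p.2.2 : E d)⟫} =
      {z | 0 < ⟪z - t • x, (p.2.2 : E d)⟫} := by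
    ext z
    simp only [mem_preimage, dilation_symm_apply, Set.mem_ofPred_eq, key]
    exact mul_pos_iff_of_pos_left (inv_pos.2 ht)
  have hS2 : (dilation t ht).symm ⁻¹' {y | ⟪y - x, (p.2.2 : E d)⟫ < 0} =
      {z | ⟪z - t • x, (p.2.2 : E d)⟫ < 0} := by
    ext z
    simp only [mem_preimage, dilation_symm_apply, Set.mem_ofPred_eq, key]
    exact smul_neg_iff_of_pos_left (inv_pos.2 ht)
  rw [hS1] at h1
  rw [hS2] at h2
  exact ⟨h.1, h1, h2⟩

lemma comp_dilation_dilation_inv (u : E d → E d) :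
    (u ∘ (dilation t ht).symm) ∘ (dilation t⁻¹ (inv_pos.2 ht)).symm = u := by
  ext1 y
  simp [ht.ne']

/-- Stated as an equality of predicates, so that the choice made in `jumpValue` is literally the
same on both sides. -/
lemma isJump_comp_dilation (u : E d → E d) (x : E d) :
    IsJump (u ∘ (dilation t ht).symm) (t • x) = IsJump u x := by
  ext p
  refine ⟨fun h => ?_, fun h => h.comp_dilation ht⟩
  have := h.comp_dilation (inv_pos.2 ht)
  rwa [comp_dilation_dilation_inv, inv_smul_smul₀ ht.ne'] at this

lemma jumpSet_dilation (U : Set (E d)) (u : E d → E d) :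
    jumpSet ((dilation t ht).symm ⁻¹' U) (u ∘ (dilation t ht).symm) =
      (dilation t ht).symm ⁻¹' jumpSet U u := by
  ext z
  have := isJump_comp_dilation ht u (t⁻¹ • z)
  rw [smul_inv_smul₀ ht.ne'] at this
  simp only [jumpSet, Set.mem_ofPred_eq, mem_preimage, this, dilation_symm_apply]

lemma jumpValue_dilation (g : E d → E d → Sph d → ℝ) (u : E d → E d) (y : E d) :
    jumpValue g (u ∘ (dilation t ht).symm) (t • y) =
      jumpValue (fun x => g (t • x)) u y := by
  simp only [jumpValue]
  generalize hP : IsJump (u ∘ (dilation t ht).symm) (t • y) = P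
  rw [isJump_comp_dilation] at hP
  subst hP
  rfl

lemma cantorPart_dilation {U : Set (E d)} (hU : IsOpen U) {u : E d → E d} (h : BD U u)
    (hd : 1 ≤ d) : cantorPart ((dilation t ht).symm ⁻¹' U) (u ∘ (dilation t ht).symm) =
      t ^ (d - 1) • (cantorPart U u).map (dilation t ht) := by
  have hset : (dilation t ht).symm ⁻¹' U \ jumpSet ((dilation t ht).symm ⁻¹' U)
      (u ∘ (dilation t ht).symm) = (dilation t ht).symm ⁻¹' (U \ jumpSet U u) := by
    rw [jumpSet_dilation, preimage_sdiff]
  rw [cantorPart, hset, singularPart_dilation ht hU h hd, VectorMeasure.restrict_smul, cantorPart]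
  congr 1
  -- The restriction to a nonmeasurable set is zero by convention, so measurability of the jump set
  -- need not be proved.
  by_cases hm : MeasurableSet (U \ jumpSet U u)
  · have hS : dilation t ht ⁻¹' ((dilation t ht).symm ⁻¹' (U \ jumpSet U u)) =
        U \ jumpSet U u := by
      ext y
      simp [ht.ne']
    rw [VectorMeasure.restrict_map _ (dilation t ht).measurable
      ((dilation t ht).symm.measurable hm), hS]
  · rw [VectorMeasure.restrict_not_measurable _ hm, VectorMeasure.restrict_not_measurable _
      (by rwa [(dilation t ht).symm.measurableSet_preimage]), VectorMeasure.map_zero]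

lemma variation_smul_map_measurableEquiv {V : Type*} [NormedAddCommGroup V] [NormedSpace ℝ V]
    (μ : VectorMeasure (E d) V) (e : E d ≃ᵐ E d) {a : ℝ} (ha : 0 ≤ a) :
    (a • μ.map e).variation = ENNReal.ofReal a • μ.variation.map e := by
  rw [VectorMeasure.variation_smul, e.measurableEmbedding.variation_map,
    ← Real.enorm_of_nonneg ha]
  rfl

lemma variation_smul_map (μ : VectorMeasure (E d) (SymMat d)) (e : E d ≃ᵐ E d) {a : ℝ}
    (ha : 0 ≤ a) : (a • μ.map e).variation = ENNReal.ofReal a • μ.variation.map e :=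
  variation_smul_map_measurableEquiv μ e ha

/-- Each term scales by `t^(d-1)`. In the bulk term `t^d` from the volume meets `1/t` from
homogeneity. In the Cantor term the variation scales and the polar density is unchanged. In the jump
term the amplitude is unchanged and only the surface measure scales. -/
lemma energy_dilation {f : E d → SymMat d → ℝ} (hf : ∀ x A (s : ℝ), 0 < s → f x (s • A) = s * f x A)
    (g : E d → E d → Sph d → ℝ) {U : Set (E d)} (hU : IsOpen U) {u : E d → E d} (h : BD U u)
    (hd : 1 ≤ d) :
    energy f g (u ∘ (dilation t ht).symm) ((dilation t ht).symm ⁻¹' U) =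
      ENNReal.ofReal (t ^ (d - 1)) *
        energy (fun x => f (t • x)) (fun x => g (t • x)) u U := by
  have hpow : t ^ d = t ^ (d - 1) * t := by rw [← pow_succ, Nat.sub_add_cancel hd]
  have htp : 0 < t ^ (d - 1) := by positivity
  have hvar := variation_smul_map (cantorPart U u) (dilation t ht) htp.le
  rw [energy, energy, mul_add, mul_add]
  congr 1
  · congr 1
    · rw [setLIntegral_smul_map _ _ (volume_eq_smul_map_dilation ht), hpow,
        ENNReal.ofReal_mul htp.le, mul_assoc, ← lintegral_const_mul' _ _ ENNReal.ofReal_ne_top]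
      congr 1
      refine lintegral_congr_ae (ae_restrict_of_ae ?_)
      filter_upwards [acDensity_dilation ht hU h hd] with y hy
      rw [dilation_apply, hy, hf _ _ _ (inv_pos.2 ht), ← ENNReal.ofReal_mul ht.le,
        mul_inv_cancel_left₀ ht.ne']
    · rw [cantorPart_dilation ht hU h hd, setLIntegral_smul_map _ _ hvar]
      have := isFiniteMeasure_variation (cantorPart U u)
      congr 1
      refine lintegral_congr_ae (ae_restrict_of_ae ?_)
      filter_upwards [@density_smul_map d (cantorPart U u) (cantorPart U u).variation _
        inferInstance (dilation t ht) _ _ htp hvar] with y hy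
      rw [hy, div_self htp.ne', one_smul]
      rfl
  · rw [jumpSet_dilation, setLIntegral_smul_map _ _
      (euclideanHausdorffMeasure_eq_smul_map_dilation ht (d - 1))]
    simp only [dilation_apply, jumpValue_dilation]

lemma EqOnBoundary.comp_dilation {U : Set (E d)} {u v : E d → E d} (h : EqOnBoundary U u v) :
    EqOnBoundary ((dilation t ht).symm ⁻¹' U) (u ∘ (dilation t ht).symm)
      (v ∘ (dilation t ht).symm) := by
  have hfr : frontier ((dilation t ht).symm ⁻¹' U) = (dilation t ht).symm ⁻¹' frontier U :=
    ((Homeomorph.smulOfNeZero t⁻¹ (inv_pos.2 ht).ne').preimage_frontier U).symm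
  have hS : dilation t ht ⁻¹' ((dilation t ht).symm ⁻¹' frontier U) = frontier U := by
    ext y
    simp [ht.ne']
  rw [EqOnBoundary, HasTrace, hfr, euclideanHausdorffMeasure_eq_smul_map_dilation ht (d - 1),
    Measure.restrict_smul, MeasurableEquiv.restrict_map, hS, Measure.ae_ennreal_smul_measure_iff
      (ENNReal.ofReal_pos.2 (by positivity)).ne', (dilation t ht).measurableEmbedding.ae_map_iff]
  filter_upwards [h] with x hx
  have := tendsto_mean_dilation ht x U (fun y => u y - v y) (by simpa using hx)
  simpa using this

lemma minValue_dilation_le {f : E d → SymMat d → ℝ}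
    (hf : ∀ x A (s : ℝ), 0 < s → f x (s • A) = s * f x A)
    (g : E d → E d → Sph d → ℝ) {U : Set (E d)} (hU : IsOpen U) (v : E d → E d) (hd : 1 ≤ d) :
    minValue f g (v ∘ (dilation t ht).symm) ((dilation t ht).symm ⁻¹' U) ≤
      ENNReal.ofReal (t ^ (d - 1)) *
        minValue (fun x => f (t • x)) (fun x => g (t • x)) v U := by
  have hc : ENNReal.ofReal (t ^ (d - 1)) ≠ 0 := (ENNReal.ofReal_pos.2 (by positivity)).ne'
  have hc' : ENNReal.ofReal (t ^ (d - 1)) ≠ ⊤ := ENNReal.ofReal_ne_top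
  simp only [minValue, ENNReal.mul_iInf_of_ne hc hc']
  refine le_iInf fun u => le_iInf fun hu => le_iInf fun hb => ?_
  rw [← energy_dilation ht hf g hU hu hd]
  exact iInf_le_of_le _ (iInf_le_of_le (hu.comp_dilation ht hU hd)
    (iInf_le_of_le (hb.comp_dilation ht) le_rfl))

lemma minValue_dilation {f : E d → SymMat d → ℝ}
    (hf : ∀ x A (s : ℝ), 0 < s → f x (s • A) = s * f x A)
    (g : E d → E d → Sph d → ℝ) {U : Set (E d)} (hU : IsOpen U) (v : E d → E d) (hd : 1 ≤ d) :
    minValue f g (v ∘ (dilation t ht).symm) ((dilation t ht).symm ⁻¹' U) =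
      ENNReal.ofReal (t ^ (d - 1)) *
        minValue (fun x => f (t • x)) (fun x => g (t • x)) v U := by
  refine le_antisymm (minValue_dilation_le ht hf g hU v hd) ?_
  -- The reverse inequality is the same estimate for the inverse dilation.
  have h := minValue_dilation_le (inv_pos.2 ht) (f := fun x => f (t • x))
    (fun x A s hs => hf _ A s hs) (fun x => g (t • x)) (isOpen_dilation ht hU)
    (v ∘ (dilation t ht).symm) hd
  have hS : (dilation t⁻¹ (inv_pos.2 ht)).symm ⁻¹' ((dilation t ht).symm ⁻¹' U) = U := by
    ext y
    simp [ht.ne']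
  simp only [comp_dilation_dilation_inv, hS, smul_inv_smul₀ ht.ne'] at h
  refine (mul_le_mul_right h _).trans_eq ?_
  rw [← mul_assoc, ← ENNReal.ofReal_mul (by positivity), ← mul_pow, mul_inv_cancel₀ ht.ne',
    one_pow, ENNReal.ofReal_one, one_mul]

end

section

variable {d n : ℕ}

/-! ### Rotations and coordinates adapted to a cube -/

lemma norm_rot (A : Matrix.specialOrthogonalGroup (Fin d) ℝ) (y : E d) : ‖rot A y‖ = ‖y‖ := by
  have hA : star (A : Matrix (Fin d) (Fin d) ℝ) * (A : Matrix (Fin d) (Fin d) ℝ) = 1 :=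
    (Matrix.mem_orthogonalGroup_iff' _ _).1 (Matrix.mem_specialOrthogonalGroup_iff.1 A.2).1
  refine (ContinuousLinearMap.norm_map_iff_adjoint_comp_self
    (Matrix.toEuclideanCLM (𝕜 := ℝ) (A : Matrix (Fin d) (Fin d) ℝ))).2 ?_ y
  rw [← ContinuousLinearMap.star_eq_adjoint, ← map_star]
  exact (map_mul (Matrix.toEuclideanCLM (𝕜 := ℝ) (n := Fin d)) _ _).symm.trans
    ((congrArg _ hA).trans (map_one _))

/-- A rotation as a linear isometric equivalence. -/
def rotEquiv (A : Matrix.specialOrthogonalGroup (Fin d) ℝ) : E d ≃ₗᵢ[ℝ] E d :=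
  LinearIsometry.toLinearIsometryEquiv
    ⟨(Matrix.toEuclideanCLM (𝕜 := ℝ) (A : Matrix (Fin d) (Fin d) ℝ)).toLinearMap, norm_rot A⟩ rfl

@[simp] lemma rotEquiv_apply (A : Matrix.specialOrthogonalGroup (Fin d) ℝ) (y : E d) :
    rotEquiv A y = rot A y := rfl

/-- The point `x + A (z, s)`, where `s` is the last coordinate. -/
def slab (A : Matrix.specialOrthogonalGroup (Fin (n + 1)) ℝ) (x : E (n + 1)) (p : ℝ × E n) :
    E (n + 1) :=
  x + rotEquiv A (WithLp.toLp 2 (Fin.insertNth (Fin.last n) p.1 (WithLp.ofLp p.2)))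

lemma measurePreserving_slab (A : Matrix.specialOrthogonalGroup (Fin (n + 1)) ℝ)
    (x : E (n + 1)) : MeasurePreserving (slab A x) (volume.prod volume) volume := by
  have h1 : MeasurePreserving (Prod.map id WithLp.ofLp : ℝ × E n → ℝ × (Fin n → ℝ))
      (volume.prod volume) (volume.prod volume) :=
    (MeasurePreserving.id volume).prod (PiLp.volume_preserving_ofLp (Fin n))
  have h2 := (volume_preserving_piFinSuccAbove (fun _ : Fin (n + 1) => ℝ) (Fin.last n)).symm
  have h3 := PiLp.volume_preserving_toLp (Fin (n + 1))
  exact (measurePreserving_add_left volume x).comp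
    ((rotEquiv A).measurePreserving.comp (h3.comp (h2.comp h1)))

lemma slab_eq (A : Matrix.specialOrthogonalGroup (Fin (n + 1)) ℝ) (x : E (n + 1)) (s : ℝ)
    (z : E n) : slab A x (s, z) =
      slab A x (0, z) + s • rot A (EuclideanSpace.single (Fin.last n) 1) := by
  have : (WithLp.toLp 2 (Fin.insertNth (Fin.last n) s (WithLp.ofLp z) : Fin (n + 1) → ℝ) :
      E (n + 1)) = WithLp.toLp 2 (Fin.insertNth (Fin.last n) 0 (WithLp.ofLp z)) +
        s • EuclideanSpace.single (Fin.last n) 1 := by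
    ext i
    refine Fin.lastCases ?_ (fun i => ?_) i <;> simp
  simp only [slab]
  rw [this, map_add, map_smul, add_assoc, rotEquiv_apply, rotEquiv_apply]

lemma isometry_slab (A : Matrix.specialOrthogonalGroup (Fin (n + 1)) ℝ) (x : E (n + 1)) :
    Isometry fun z : E n => slab A x (0, z) := by
  refine Isometry.of_dist_eq fun z w => ?_
  simp only [slab]
  rw [dist_add_left, LinearIsometryEquiv.dist_map, EuclideanSpace.dist_eq, EuclideanSpace.dist_eq,
    Fin.sum_univ_castSucc]
  simp

lemma inner_slab_sub (A : Matrix.specialOrthogonalGroup (Fin (n + 1)) ℝ) (x : E (n + 1)) (s : ℝ)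
    (z : E n) :
    ⟪slab A x (s, z) - x, rot A (EuclideanSpace.single (Fin.last n) 1)⟫ = s := by
  simp only [slab, add_sub_cancel_left]
  rw [← rotEquiv_apply, LinearIsometryEquiv.inner_map_map, EuclideanSpace.inner_single_right]
  simp

lemma slab_surjective (A : Matrix.specialOrthogonalGroup (Fin (n + 1)) ℝ) (x : E (n + 1)) :
    Function.Surjective (slab A x) := by
  intro y
  refine ⟨((rotEquiv A).symm (y - x) (Fin.last n),
    WithLp.toLp 2 fun i => (rotEquiv A).symm (y - x) i.castSucc), ?_⟩
  have : (WithLp.toLp 2 (Fin.insertNth (Fin.last n) ((rotEquiv A).symm (y - x) (Fin.last n))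
      fun i => (rotEquiv A).symm (y - x) i.castSucc : Fin (n + 1) → ℝ) : E (n + 1)) =
        (rotEquiv A).symm (y - x) := by
    ext i
    refine Fin.lastCases ?_ (fun i => ?_) i <;> simp
  simp only [slab]
  rw [this, LinearIsometryEquiv.apply_symm_apply, add_sub_cancel]

lemma rotCube_eq_preimage (R : Sph d → Matrix.specialOrthogonalGroup (Fin d) ℝ) (ν : Sph d)
    (x : E d) (ρ : ℝ) :
    rotCube R ν x ρ = (fun y => (rotEquiv (R ν)).symm (y - x)) ⁻¹' cube 0 ρ := by
  ext y
  constructor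
  · rintro ⟨z, hz, rfl⟩
    have : (rotEquiv (R ν)).symm (rot (R ν) z) = z := (rotEquiv (R ν)).symm_apply_apply z
    simpa [this] using hz
  · intro hy
    exact ⟨_, hy, by simp [← rotEquiv_apply]⟩

lemma cube_eq_preimage_pi (ρ : ℝ) :
    cube (0 : E d) ρ = WithLp.ofLp ⁻¹' univ.pi fun _ : Fin d => Ioo (-(ρ / 2)) (ρ / 2) := by
  ext y
  simp [cube, abs_lt]

lemma isOpen_rotCube (R : Sph d → Matrix.specialOrthogonalGroup (Fin d) ℝ) (ν : Sph d)
    (x : E d) (ρ : ℝ) : IsOpen (rotCube R ν x ρ) := by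
  rw [rotCube_eq_preimage, cube_eq_preimage_pi]
  refine ((isOpen_set_pi finite_univ fun _ _ => isOpen_Ioo).preimage
    (PiLp.continuous_ofLp 2 _)).preimage ?_
  exact (rotEquiv (R ν)).symm.continuous.comp (continuous_id.sub continuous_const)

lemma volume_cube (ρ : ℝ) : volume (cube (0 : E d) ρ) = ENNReal.ofReal ρ ^ d := by
  rw [cube_eq_preimage_pi, (PiLp.volume_preserving_ofLp (Fin d)).measure_preimage
    (MeasurableSet.univ_pi fun _ => measurableSet_Ioo).nullMeasurableSet, Real.volume_pi_Ioo]
  simp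

lemma measurableSet_cube (ρ : ℝ) : MeasurableSet (cube (0 : E d) ρ) := by
  rw [cube_eq_preimage_pi]
  exact (MeasurableSet.univ_pi fun _ => measurableSet_Ioo).preimage
    (PiLp.continuous_ofLp 2 _).measurable

lemma volume_rotCube (R : Sph d → Matrix.specialOrthogonalGroup (Fin d) ℝ) (ν : Sph d)
    (x : E d) (ρ : ℝ) : volume (rotCube R ν x ρ) = ENNReal.ofReal ρ ^ d := by
  have h : MeasurePreserving (fun y => (rotEquiv (R ν)).symm (y - x)) volume volume :=
    (rotEquiv (R ν)).symm.measurePreserving.comp (measurePreserving_sub_right volume x)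
  rw [rotCube_eq_preimage, h.measure_preimage (measurableSet_cube ρ).nullMeasurableSet,
    volume_cube]

lemma slab_mem_rotCube_iff {R : Sph (n + 1) → Matrix.specialOrthogonalGroup (Fin (n + 1)) ℝ}
    {ν : Sph (n + 1)} {x : E (n + 1)} {ρ : ℝ} (hρ : 0 < ρ) (z : E n) :
    slab (R ν) x (0, z) ∈ rotCube R ν x ρ ↔ z ∈ cube 0 ρ := by
  rw [rotCube_eq_preimage]
  simp [slab, cube, Fin.forall_fin_succ', hρ, -rotEquiv_apply]

lemma rotCube_dilation {t : ℝ} (ht : 0 < t)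
    (R : Sph d → Matrix.specialOrthogonalGroup (Fin d) ℝ) (ν : Sph d) (x : E d) (ρ : ℝ) :
    (dilation t ht).symm ⁻¹' rotCube R ν x ρ = rotCube R ν (t • x) (t * ρ) := by
  ext y
  rw [rotCube_eq_preimage, rotCube_eq_preimage]
  have : t⁻¹ • y - x = t⁻¹ • (y - t • x) := by rw [smul_sub, inv_smul_smul₀ ht.ne']
  simp only [mem_preimage, dilation_symm_apply, this, map_smul, cube, Set.mem_ofPred_eq, sub_zero,
    PiLp.smul_apply, smul_eq_mul, abs_mul, abs_of_pos (inv_pos.2 ht)]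
  refine forall_congr' fun i => ?_
  rw [inv_mul_lt_iff₀ ht, mul_div_assoc]

lemma jumpFun_dilation {t : ℝ} (ht : 0 < t) (x ζ : E d) (ν : Sph d) :
    jumpFun x ζ ν ∘ (dilation t ht).symm = jumpFun (t • x) ζ ν := by
  ext1 y
  have : t⁻¹ • y - x = t⁻¹ • (y - t • x) := by rw [smul_sub, inv_smul_smul₀ ht.ne']
  simp only [Function.comp, jumpFun, dilation_symm_apply, this, real_inner_smul_left]
  simp only [mul_pos_iff_of_pos_left (inv_pos.2 ht)]

end

section

variable {d n : ℕ}

/-! ### The gradient of a test function integrated over a half-space -/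

/-- The indicator of the half-space is constant along `w`, so its line derivative vanishes and
integration by parts leaves nothing. -/
lemma integral_halfSpace_fderiv_tangential {φ : E d → ℝ} (hφ : ContDiff ℝ ∞ φ)
    (hc : HasCompactSupport φ) (x : E d) {v w : E d} (hw : ⟪w, v⟫ = 0) :
    ∫ y in {y | 0 < ⟪y - x, v⟫}, fderiv ℝ φ y w = 0 := by
  set H : Set (E d) := {y | 0 < ⟪y - x, v⟫} with hH
  have hHo : IsOpen H := isOpen_lt continuous_const (by fun_prop)
  have hd : Differentiable ℝ φ := hφ.differentiable (by simp)
  have hI : Integrable φ := hφ.continuous.integrable_of_hasCompactSupport hc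
  have hI' : Integrable fun y => fderiv ℝ φ y w :=
    ((hφ.continuous_fderiv (by simp)).clm_apply continuous_const).integrable_of_hasCompactSupport
      (hc.fderiv_apply ℝ w)
  have hmul : ∀ ψ : E d → ℝ, (fun y => ContinuousLinearMap.mul ℝ ℝ (H.indicator 1 y) (ψ y)) =
      H.indicator ψ := by
    intro ψ
    ext y
    by_cases hy : y ∈ H <;> simp [hy]
  have hline : ∀ y : E d, HasLineDerivAt ℝ (H.indicator (1 : E d → ℝ)) 0 y w := by
    intro y
    have : (fun s : ℝ => H.indicator (1 : E d → ℝ) (y + s • w)) =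
        fun _ => H.indicator (1 : E d → ℝ) y := by
      ext s
      have h : y + s • w ∈ H ↔ y ∈ H := by
        simp only [hH, Set.mem_ofPred_eq, add_sub_right_comm, inner_add_left,
          real_inner_smul_left, hw, mul_zero, add_zero]
      by_cases hy : y ∈ H
      · simp [hy, h.2 hy]
      · simp [hy, mt h.1 hy]
    rw [HasLineDerivAt, this]
    exact hasDerivAt_const _ _
  have key := integral_bilinear_hasLineDerivAt_right_eq_neg_left_of_integrable (μ := volume)
    (f := H.indicator (1 : E d → ℝ)) (f' := fun _ => 0) (g := φ)
    (g' := fun y => fderiv ℝ φ y w) (v := w) (B := ContinuousLinearMap.mul ℝ ℝ)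
    (by simp) (by rw [hmul]; exact hI'.indicator hHo.measurableSet)
    (by rw [hmul]; exact hI.indicator hHo.measurableSet) (fun y _ => hline y)
    (fun y _ => (hd y).hasFDerivAt.hasLineDerivAt w)
  rw [hmul, integral_indicator hHo.measurableSet] at key
  simpa using key

lemma slab_preimage_halfSpace (A : Matrix.specialOrthogonalGroup (Fin (n + 1)) ℝ)
    (x : E (n + 1)) :
    slab A x ⁻¹' {y | 0 < ⟪y - x, rot A (EuclideanSpace.single (Fin.last n) 1)⟫} =
      Ioi 0 ×ˢ univ := by
  ext p
  simp only [mem_preimage, Set.mem_ofPred_eq, mem_prod, mem_Ioi, mem_univ, and_true]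
  rw [← Prod.mk.eta (p := p), inner_slab_sub]

/-- In the coordinates of `slab`, Fubini reduces the claim to the fundamental theorem of calculus on
half-lines normal to the hyperplane. -/
lemma integral_halfSpace_fderiv_normal {φ : E (n + 1) → ℝ} (hφ : ContDiff ℝ ∞ φ)
    (hc : HasCompactSupport φ) (A : Matrix.specialOrthogonalGroup (Fin (n + 1)) ℝ)
    (x : E (n + 1)) {v : E (n + 1)} (hv : rot A (EuclideanSpace.single (Fin.last n) 1) = v) :
    ∫ y in {y | 0 < ⟪y - x, v⟫}, fderiv ℝ φ y v = -∫ z, φ (slab A x (0, z)) := by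
  have hv1 : ‖v‖ = 1 := by rw [← hv, norm_rot]; simp
  have hd : Differentiable ℝ φ := hφ.differentiable (by simp)
  have hcont : Continuous fun y => fderiv ℝ φ y v :=
    (hφ.continuous_fderiv (by simp)).clm_apply continuous_const
  have hI' : Integrable fun y => fderiv ℝ φ y v :=
    hcont.integrable_of_hasCompactSupport (hc.fderiv_apply ℝ v)
  have hP := measurePreserving_slab A x
  have hmeas : MeasurableSet {y : E (n + 1) | 0 < ⟪y - x, v⟫} :=
    (isOpen_lt continuous_const (by fun_prop)).measurableSet
  have hpre := slab_preimage_halfSpace A x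
  rw [hv] at hpre
  have hIp : Integrable (fun p => fderiv ℝ φ (slab A x p) v)
      ((volume.restrict (Ioi (0 : ℝ))).prod (volume : Measure (E n))) := by
    have h := (hP.integrable_comp hI'.aestronglyMeasurable).2 hI'
    rw [← Measure.restrict_univ (μ := (volume : Measure (E n))), Measure.prod_restrict]
    exact h.restrict
  conv_lhs => rw [← hP.map_eq, Measure.restrict_map hP.measurable hmeas, hpre,
    ← Measure.prod_restrict, Measure.restrict_univ,
    integral_map hP.measurable.aemeasurable hcont.aestronglyMeasurable, integral_prod_symm _ hIp]
  rw [← integral_neg]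
  refine integral_congr_ae (ae_of_all _ fun z => ?_)
  have hiso : Isometry fun s : ℝ => slab A x (0, z) + s • v := by
    refine Isometry.of_dist_eq fun s t => ?_
    rw [dist_add_left, dist_eq_norm, ← sub_smul, norm_smul, hv1, mul_one, dist_eq_norm]
  have h1 : ContDiff ℝ 1 fun s : ℝ => φ (slab A x (0, z) + s • v) :=
    (hφ.of_le (by simp)).comp (contDiff_const.add (contDiff_id.smul contDiff_const))
  have h2 : HasCompactSupport fun s : ℝ => φ (slab A x (0, z) + s • v) :=
    hc.comp_isClosedEmbedding hiso.isClosedEmbedding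
  have h3 := h2.integral_Ioi_deriv_eq h1 0
  rw [zero_smul, add_zero] at h3
  refine Eq.trans ?_ h3
  refine integral_congr_ae (ae_of_all _ fun s => ?_)
  have h4 : HasDerivAt (fun s : ℝ => slab A x (0, z) + s • v) v s := by
    simpa using ((hasDerivAt_id s).smul_const v).const_add (slab A x (0, z))
  have h5 := (hd (slab A x (0, z) + s • v)).hasFDerivAt.comp_hasDerivAt s h4
  dsimp only
  rw [slab_eq A x s z, hv]
  exact h5.deriv.symm

lemma integral_halfSpace_gradient {φ : E (n + 1) → ℝ} (hφ : ContDiff ℝ ∞ φ)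
    (hc : HasCompactSupport φ) (A : Matrix.specialOrthogonalGroup (Fin (n + 1)) ℝ)
    (x : E (n + 1)) {v : E (n + 1)} (hv : rot A (EuclideanSpace.single (Fin.last n) 1) = v) :
    ∫ y in {y | 0 < ⟪y - x, v⟫}, gradient φ y = -(∫ z, φ (slab A x (0, z))) • v := by
  have hv1 : ‖v‖ = 1 := by rw [← hv, norm_rot]; simp
  have hcont : Continuous (gradient φ) :=
    (InnerProductSpace.toDual ℝ (E (n + 1))).symm.continuous.comp (hφ.continuous_fderiv (by simp))
  have hI : Integrable (gradient φ) := by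
    refine hcont.integrable_of_hasCompactSupport ?_
    exact (hc.fderiv ℝ).comp_left (map_zero (InnerProductSpace.toDual ℝ (E (n + 1))).symm)
  have hgrad : ∀ y w, ⟪w, gradient φ y⟫ = fderiv ℝ φ y w := by
    intro y w
    rw [real_inner_comm, gradient, InnerProductSpace.toDual_symm_apply]
  have hId : ∀ w, Integrable fun y => fderiv ℝ φ y w := fun w => by
    simpa only [hgrad] using hI.const_inner (𝕜 := ℝ) w
  refine ext_inner_left ℝ fun w => ?_
  rw [← integral_inner hI.restrict w]
  simp only [hgrad]
  have hw : ⟪w - ⟪w, v⟫ • v, v⟫ = 0 := by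
    rw [inner_sub_left, real_inner_smul_left, real_inner_self_eq_norm_sq, hv1]
    ring
  have hsplit : ∀ y, fderiv ℝ φ y w =
      ⟪w, v⟫ * fderiv ℝ φ y v + fderiv ℝ φ y (w - ⟪w, v⟫ • v) := by
    intro y
    rw [map_sub, map_smul, smul_eq_mul]
    ring
  simp only [hsplit]
  rw [integral_add ((hId v).restrict.const_mul _) (hId _).restrict, integral_const_mul,
    integral_halfSpace_fderiv_normal hφ hc A x hv,
    integral_halfSpace_fderiv_tangential hφ hc x hw, real_inner_smul_right]
  ring

/-! ### Measures with constant density -/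

section ConstDensity

variable {V : Type*} [NormedAddCommGroup V] [NormedSpace ℝ V] [CompleteSpace V]
  (m : Measure (E d)) [IsFiniteMeasure m] (A : V)

lemma withDensityᵥ_const_apply {B : Set (E d)} (hB : MeasurableSet B) :
    (m.withDensityᵥ fun _ => A) B = m.real B • A := by
  rw [withDensityᵥ_apply (integrable_const A) hB, setIntegral_const]

lemma integral_withDensityᵥ_const (hfin : IsFiniteMeasure (m.withDensityᵥ fun _ => A).variation)
    {φ : E d → ℝ} (hφ : Continuous φ) (hc : HasCompactSupport φ) :
    ∫ᵛ x, φ x ∂•(m.withDensityᵥ fun _ => A) = (∫ x, φ x ∂m) • A := by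
  have hvar : (m.withDensityᵥ fun _ => A).variation = ‖A‖ₑ • m := by
    rw [Measure.variation_withDensityᵥ (integrable_const A), withDensity_const]
  -- The variation is `‖A‖ m`, so the constant density with respect to it is `‖A‖⁻¹ • A`; for `A =
  -- 0` the convention `0⁻¹ = 0` is harmless.
  have hA : ‖A‖ • ‖A‖⁻¹ • A = A := by
    by_cases h : A = 0
    · simp [h]
    · rw [smul_inv_smul₀ (norm_ne_zero_iff.2 h)]
  rw [integral_of_forall_eq_smul hfin (A := ‖A‖⁻¹ • A) (fun B hB => ?_)
    (integrable_of_continuous_hasCompactSupport hfin hφ hc), hvar, integral_smul_measure]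
  · rw [toReal_enorm, smul_assoc, smul_comm, hA]
  · rw [withDensityᵥ_const_apply m A hB, hvar, measureReal_ennreal_smul_apply, toReal_enorm,
      mul_comm, mul_smul, hA]

end ConstDensity

/-- A matrix-valued measure with constant density with respect to a positive measure. -/
def constDensity (m : Measure (E d)) (A : SymMat d) : VectorMeasure (E d) (SymMat d) :=
  m.withDensityᵥ fun _ => A

lemma constDensity_apply (m : Measure (E d)) [IsFiniteMeasure m] (A : SymMat d) {B : Set (E d)}
    (hB : MeasurableSet B) : constDensity m A B = m.real B • A :=
  withDensityᵥ_const_apply m A hB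

lemma integral_constDensity (m : Measure (E d)) [IsFiniteMeasure m] (A : SymMat d)
    {φ : E d → ℝ} (hφ : Continuous φ) (hc : HasCompactSupport φ) :
    ∫ᵛ x, φ x ∂•(constDensity m A) = (∫ x, φ x ∂m) • A :=
  integral_withDensityᵥ_const m A (isFiniteMeasure_variation (constDensity m A)) hφ hc

lemma density_constDensity {m l : Measure (E d)} [IsFiniteMeasure m] (hml : m ⟂ₘ l)
    (A : SymMat d) : density (constDensity m A) l =ᵐ[l] 0 := by
  have key : ∀ i j, (entryMeasure (constDensity m A) i j).rnDeriv l =ᵐ[l] 0 := by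
    intro i j
    obtain ⟨S, hS, hmS, hlS⟩ := hml
    refine (SignedMeasure.eq_rnDeriv (entryMeasure (constDensity m A) i j) (0 : E d → ℝ)
      (integrable_zero _ _ _) ?_ ?_).symm
    · refine VectorMeasure.MutuallySingular.mk S hS (fun B hB hBm => ?_)
        (fun B hB hBm => ?_)
      · rw [entryMeasure_apply, constDensity_apply _ _ hBm, Measure.real,
          measure_mono_null (by simpa using hB) hmS]
        simp
      · rw [Measure.toENNRealVectorMeasure_apply_measurable hBm]
        exact measure_mono_null (by simpa using hB) hlS
    · simp
  have hall : ∀ᵐ x ∂l, ∀ i j, (entryMeasure (constDensity m A) i j).rnDeriv l x = 0 := by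
    rw [ae_all_iff]
    intro i
    rw [ae_all_iff]
    exact key i
  filter_upwards [hall] with x hx
  simp [density, hx]

end

section

variable {d n : ℕ}

/-! ### Jump points of a function with two values -/

/-- An approximate one-sided limit is a limit of values taken arbitrarily close to the point. -/
lemma exists_enorm_sub_lt {u : E (n + 1) → E (n + 1)} {x a : E (n + 1)} {v : E (n + 1)}
    (hv : ‖v‖ = 1) (h : Tendsto (fun ρ : ℝ => (ENNReal.ofReal (ρ ^ (n + 1)))⁻¹ *
      ∫⁻ y in Metric.ball x ρ ∩ {y | 0 < ⟪y - x, v⟫}, ‖u y - a‖ₑ) (𝓝[>] 0) (𝓝 0))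
    {δ : ℝ≥0∞} (hδ : δ ≠ 0) {ρ₀ : ℝ} (hρ₀ : 0 < ρ₀) :
    ∃ y ∈ Metric.ball x ρ₀, ‖u y - a‖ₑ < δ := by
  by_contra! hcon
  set c : ℝ≥0∞ := ENNReal.ofReal (2⁻¹ ^ (n + 1)) * volume (Metric.ball (0 : E (n + 1)) 1) with hc
  have hc0 : 0 < c := by
    refine pos_iff_ne_zero.2 (mul_ne_zero (ENNReal.ofReal_pos.2 (by positivity)).ne' ?_)
    exact (Metric.measure_ball_pos _ _ one_pos).ne'
  -- The half-ball contains the ball of radius `ρ/2` centred at `x + (ρ/2) v`. If `u` stayed `δ`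
  -- away from `a`, the means would be at least `δ c`.
  have hlow : ∀ᶠ ρ : ℝ in 𝓝[>] 0, δ * c ≤ (ENNReal.ofReal (ρ ^ (n + 1)))⁻¹ *
      ∫⁻ y in Metric.ball x ρ ∩ {y | 0 < ⟪y - x, v⟫}, ‖u y - a‖ₑ := by
    filter_upwards [Ioo_mem_nhdsGT hρ₀] with ρ hρ
    have hsub : Metric.ball (x + (ρ / 2) • v) (ρ / 2) ⊆
        Metric.ball x ρ ∩ {y | 0 < ⟪y - x, v⟫} := by
      intro y hy
      have hy' : ‖y - (x + (ρ / 2) • v)‖ < ρ / 2 := by simpa [dist_eq_norm] using hy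
      have hyx : y - x = (y - (x + (ρ / 2) • v)) + (ρ / 2) • v := by abel
      have hn : ‖(ρ / 2) • v‖ = ρ / 2 := by
        rw [norm_smul, hv, mul_one, Real.norm_of_nonneg (by linarith [hρ.1])]
      constructor
      · rw [Metric.mem_ball, dist_eq_norm, hyx]
        linarith [norm_add_le (y - (x + (ρ / 2) • v)) ((ρ / 2) • v)]
      · have h1 := abs_real_inner_le_norm (y - (x + (ρ / 2) • v)) v
        rw [hv, mul_one] at h1
        rw [Set.mem_ofPred_eq, hyx, inner_add_left, real_inner_smul_left,
          real_inner_self_eq_norm_sq, hv]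
        linarith [neg_le_of_abs_le h1]
    have hvol : volume (Metric.ball (x + (ρ / 2) • v) (ρ / 2)) =
        ENNReal.ofReal (ρ ^ (n + 1)) * c := by
      rw [Measure.addHaar_ball _ _ (by linarith [hρ.1]), hc, ← mul_assoc,
        ← ENNReal.ofReal_mul (pow_nonneg hρ.1.le _), ← mul_pow, finrank_euclideanSpace_fin]
      rfl
    have hpos : ENNReal.ofReal (ρ ^ (n + 1)) ≠ 0 :=
      (ENNReal.ofReal_pos.2 (pow_pos hρ.1 _)).ne'
    calc δ * c = (ENNReal.ofReal (ρ ^ (n + 1)))⁻¹ *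
          (δ * (ENNReal.ofReal (ρ ^ (n + 1)) * c)) := by
          rw [mul_left_comm δ (ENNReal.ofReal (ρ ^ (n + 1))) c,
            ENNReal.inv_mul_cancel_left hpos ENNReal.ofReal_ne_top]
      _ ≤ _ := by
          gcongr
          rw [← hvol, ← setLIntegral_const]
          refine (lintegral_mono_set hsub).trans ?_
          refine setLIntegral_mono' (measurableSet_ball.inter
            (isOpen_lt continuous_const (by fun_prop)).measurableSet) fun y hy => ?_
          exact hcon y (Metric.ball_subset_ball hρ.2.le hy.1)
  have := ge_of_tendsto h hlow
  exact (ENNReal.mul_pos hδ hc0.ne').not_ge this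

lemma setOf_inner_neg (x v : E d) : {y : E d | ⟪y - x, v⟫ < 0} = {y | 0 < ⟪y - x, -v⟫} := by
  ext y
  simp [inner_neg_right]

lemma jumpFun_eq_or (x ζ : E d) (ν : Sph d) (y : E d) :
    jumpFun x ζ ν y = ζ ∨ jumpFun x ζ ν y = 0 := by
  unfold jumpFun
  split_ifs <;> simp

lemma eq_or_eq_of_forall_exists_enorm_sub_lt {x ζ a : E d} {ν : Sph d}
    (h : ∀ δ : ℝ≥0∞, δ ≠ 0 → ∃ y, ‖jumpFun x ζ ν y - a‖ₑ < δ) : a = ζ ∨ a = 0 := by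
  by_contra! hne
  have h1 : ‖ζ - a‖ₑ ≠ 0 := by simpa [sub_eq_zero] using hne.1.symm
  have h2 : ‖(0 : E d) - a‖ₑ ≠ 0 := by simpa using hne.2
  obtain ⟨y, hy⟩ := h (min ‖ζ - a‖ₑ ‖(0 : E d) - a‖ₑ) (by
    rcases min_choice ‖ζ - a‖ₑ ‖(0 : E d) - a‖ₑ with h | h <;> rwa [h])
  rcases jumpFun_eq_or x ζ ν y with h | h <;> rw [h] at hy
  · exact hy.not_ge (min_le_left _ _)
  · exact hy.not_ge (min_le_right _ _)

/-- One-sided limits of a function with values in `{ζ, 0}` lie in `{ζ, 0}`. The bound holds for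
every admissible triple, hence for the one chosen in `jumpValue`. -/
lemma norm_sub_le_of_isJump_jumpFun {x ζ y : E (n + 1)} {ν : Sph (n + 1)}
    {p : E (n + 1) × E (n + 1) × Sph (n + 1)} (h : IsJump (jumpFun x ζ ν) y p) :
    ‖p.1 - p.2.1‖ ≤ ‖ζ‖ := by
  have hp : ‖(p.2.2 : E (n + 1))‖ = 1 := norm_eq_of_mem_sphere p.2.2
  have h1 : p.1 = ζ ∨ p.1 = 0 := eq_or_eq_of_forall_exists_enorm_sub_lt fun δ hδ =>
    let ⟨y, _, hy⟩ := exists_enorm_sub_lt hp h.2.1 hδ one_pos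
    ⟨y, hy⟩
  have h2' := h.2.2
  rw [setOf_inner_neg] at h2'
  have h2 : p.2.1 = ζ ∨ p.2.1 = 0 := eq_or_eq_of_forall_exists_enorm_sub_lt fun δ hδ =>
    let ⟨y, _, hy⟩ := exists_enorm_sub_lt (by rwa [norm_neg]) h2' hδ one_pos
    ⟨y, hy⟩
  rcases h1 with h1 | h1 <;> rcases h2 with h2 | h2 <;> simp [h1, h2]

/-- Off the hyperplane the function is locally constant, which would force the two one-sided limits
to coincide. -/
lemma inner_eq_zero_of_isJump_jumpFun {x ζ y : E (n + 1)} {ν : Sph (n + 1)}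
    {p : E (n + 1) × E (n + 1) × Sph (n + 1)} (h : IsJump (jumpFun x ζ ν) y p) :
    ⟪y - x, (ν : E (n + 1))⟫ = 0 := by
  by_contra hne
  obtain ⟨c, hc⟩ : ∃ c, ∀ᶠ z in 𝓝 y, jumpFun x ζ ν z = c := by
    have hcont : Continuous fun z : E (n + 1) => ⟪z - x, (ν : E (n + 1))⟫ := by fun_prop
    rcases lt_or_gt_of_ne hne with hlt | hgt
    · refine ⟨0, ?_⟩
      filter_upwards [hcont.continuousAt.eventually_lt continuousAt_const hlt] with z hz
      exact if_neg hz.not_gt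
    · refine ⟨ζ, ?_⟩
      filter_upwards [continuousAt_const.eventually_lt hcont.continuousAt hgt] with z hz
      exact if_pos hz
  obtain ⟨r, hr, hball⟩ := Metric.eventually_nhds_iff_ball.1 hc
  have hp : ‖(p.2.2 : E (n + 1))‖ = 1 := norm_eq_of_mem_sphere p.2.2
  have key : ∀ {a v : E (n + 1)}, ‖v‖ = 1 → Tendsto (fun ρ : ℝ =>
      (ENNReal.ofReal (ρ ^ (n + 1)))⁻¹ * ∫⁻ z in Metric.ball y ρ ∩ {z | 0 < ⟪z - y, v⟫},
        ‖jumpFun x ζ ν z - a‖ₑ) (𝓝[>] 0) (𝓝 0) → a = c := by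
    intro a v hv h
    by_contra hac
    have hδ : ‖c - a‖ₑ ≠ 0 := by simpa [sub_eq_zero] using fun h => hac h.symm
    obtain ⟨z, hz, hlt⟩ := exists_enorm_sub_lt hv h hδ hr
    rw [hball z hz] at hlt
    exact lt_irrefl _ hlt
  have h2' := h.2.2
  rw [setOf_inner_neg] at h2'
  exact h.1 ((key hp h.2.1).trans (key (by rwa [norm_neg]) h2').symm)

lemma isJump_jumpFun {x ζ y : E d} {ν : Sph d} (hζ : ζ ≠ 0)
    (hy : ⟪y - x, (ν : E d)⟫ = 0) : IsJump (jumpFun x ζ ν) y (ζ, 0, ν) := by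
  have hyz : ∀ z : E d, ⟪z - y, (ν : E d)⟫ = ⟪z - x, (ν : E d)⟫ := by
    intro z
    rw [← sub_sub_sub_cancel_right z y x, inner_sub_left _ (y - x), hy, sub_zero]
  refine ⟨hζ, ?_, ?_⟩
  · refine tendsto_const_nhds.congr fun ρ => ?_
    rw [setLIntegral_congr_fun (g := fun _ => 0) (measurableSet_ball.inter
      (isOpen_lt continuous_const (by fun_prop)).measurableSet)]
    · simp
    · intro z hz
      have : 0 < ⟪z - x, (ν : E d)⟫ := by rw [← hyz]; exact hz.2
      simp [jumpFun, this]
  · refine tendsto_const_nhds.congr fun ρ => ?_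
    rw [setLIntegral_congr_fun (g := fun _ => 0) (measurableSet_ball.inter
      (isOpen_lt (by fun_prop) continuous_const).measurableSet)]
    · simp
    · intro z hz
      have : ⟪z - x, (ν : E d)⟫ < 0 := by rw [← hyz]; exact hz.2
      simp [jumpFun, this.not_gt]

/-! ### The energy of a jump function on a cube -/

variable (R : Sph (n + 1) → Matrix.specialOrthogonalGroup (Fin (n + 1)) ℝ) (ν : Sph (n + 1))
  (x ζ : E (n + 1)) {ρ : ℝ}

/-- The surface measure of the middle section of a cube. -/
def sectionMeasure (ρ : ℝ) : Measure (E (n + 1)) :=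
  (volume.restrict (cube (0 : E n) ρ)).map fun z => slab (R ν) x (0, z)

instance (ρ : ℝ) : IsFiniteMeasure (volume.restrict (cube (0 : E n) ρ)) :=
  ⟨by rw [Measure.restrict_apply_univ, volume_cube]; finiteness⟩

instance (ρ : ℝ) : IsFiniteMeasure (sectionMeasure R ν x ρ) := by
  unfold sectionMeasure
  infer_instance

lemma sectionMeasure_apply {B : Set (E (n + 1))} (hB : MeasurableSet B) :
    sectionMeasure R ν x ρ B =
      volume.restrict (cube (0 : E n) ρ) ((fun z => slab (R ν) x (0, z)) ⁻¹' B) :=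
  Measure.map_apply (isometry_slab _ _).continuous.measurable hB

lemma sectionMeasure_compl (hρ : 0 < ρ) : sectionMeasure R ν x ρ (rotCube R ν x ρ)ᶜ = 0 := by
  rw [sectionMeasure_apply _ _ _ (isOpen_rotCube _ _ _ _).measurableSet.compl,
    Measure.restrict_apply
      ((isOpen_rotCube R ν x ρ).measurableSet.compl.preimage
        (isometry_slab _ _).continuous.measurable)]
  convert measure_empty (μ := (volume : Measure (E n)))
  ext z
  simp only [mem_inter_iff, mem_preimage, mem_compl_iff, slab_mem_rotCube_iff hρ]
  simp

variable {R} {ν}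

lemma sectionMeasure_hyperplane (hR : rot (R ν) (EuclideanSpace.single (Fin.last n) 1) = ν) :
    sectionMeasure R ν x ρ {y | ⟪y - x, (ν : E (n + 1))⟫ = 0}ᶜ = 0 := by
  have hcl : IsClosed {y : E (n + 1) | ⟪y - x, (ν : E (n + 1))⟫ = 0} :=
    isClosed_eq (by fun_prop) continuous_const
  rw [sectionMeasure_apply _ _ _ hcl.measurableSet.compl]
  convert measure_empty (μ := volume.restrict (cube (0 : E n) ρ))
  ext z
  simp [← hR, inner_slab_sub]

lemma volume_hyperplane (hR : rot (R ν) (EuclideanSpace.single (Fin.last n) 1) = ν) :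
    volume {y : E (n + 1) | ⟪y - x, (ν : E (n + 1))⟫ = 0} = 0 := by
  have hcl : IsClosed {y : E (n + 1) | ⟪y - x, (ν : E (n + 1))⟫ = 0} :=
    isClosed_eq (by fun_prop) continuous_const
  have hpre : slab (R ν) x ⁻¹' {y | ⟪y - x, (ν : E (n + 1))⟫ = 0} = {0} ×ˢ univ := by
    ext ⟨s, z⟩
    simp [← hR, inner_slab_sub]
  rw [← (measurePreserving_slab (R ν) x).measure_preimage hcl.measurableSet.nullMeasurableSet,
    hpre, Measure.prod_prod]
  simp

lemma mutuallySingular_sectionMeasure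
    (hR : rot (R ν) (EuclideanSpace.single (Fin.last n) 1) = ν) :
    sectionMeasure R ν x ρ ⟂ₘ volume := by
  have hcl : IsClosed {y : E (n + 1) | ⟪y - x, (ν : E (n + 1))⟫ = 0} :=
    isClosed_eq (by fun_prop) continuous_const
  refine ⟨_, hcl.measurableSet.compl, sectionMeasure_hyperplane x hR, ?_⟩
  rw [compl_compl]
  exact volume_hyperplane x hR

/-- The map `b ↦ a ⊙ b` as a continuous linear map. -/
def symProdCLM (a : E d) : E d →L[ℝ] SymMat d :=
  LinearMap.toContinuousLinearMap
    { toFun := symProd a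
      map_add' := fun b c => by
        ext p
        simp [symProd]
        ring
      map_smul' := fun s b => symProd_smul_right s a b }

/-- As `φ` is supported in the cube, the integral extends to the whole half-space, where the
divergence theorem turns it into an integral over the hyperplane; there only the section of the cube
contributes. -/
lemma isSymGrad_jumpFun (hR : rot (R ν) (EuclideanSpace.single (Fin.last n) 1) = ν)
    (hρ : 0 < ρ) : IsSymGrad (rotCube R ν x ρ) (jumpFun x ζ ν)
      (constDensity (sectionMeasure R ν x ρ) (symProd ζ ν)) where
  supported B hB := by
    rw [constDensity_apply _ _ hB,
      constDensity_apply _ _ (hB.inter (isOpen_rotCube R ν x ρ).measurableSet), Measure.real,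
      Measure.real, measure_inter_conull (sectionMeasure_compl R ν x hρ)]
  integral_eq φ hφ hc hs := by
    have hgrad0 : ∀ y, y ∉ rotCube R ν x ρ → gradient φ y = 0 := by
      intro y hy
      have : fderiv ℝ φ y = 0 := by
        by_contra hne
        exact hy (hs (support_fderiv_subset ℝ hne))
      rw [gradient, this, map_zero]
    have hHm : MeasurableSet {y : E (n + 1) | 0 < ⟪y - x, (ν : E (n + 1))⟫} :=
      (isOpen_lt continuous_const (by fun_prop)).measurableSet
    have hI : Integrable (gradient φ) := by
      have hcont : Continuous (gradient φ) :=
        (InnerProductSpace.toDual ℝ (E (n + 1))).symm.continuous.comp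
          (hφ.continuous_fderiv (by simp))
      refine hcont.integrable_of_hasCompactSupport ?_
      exact (hc.fderiv ℝ).comp_left (map_zero (InnerProductSpace.toDual ℝ (E (n + 1))).symm)
    have hind : ∀ y, symProd (jumpFun x ζ ν y) (gradient φ y) =
        {y : E (n + 1) | 0 < ⟪y - x, (ν : E (n + 1))⟫}.indicator
          (fun y => symProdCLM ζ (gradient φ y)) y := by
      intro y
      by_cases hy : 0 < ⟪y - x, (ν : E (n + 1))⟫
      · rw [indicator_of_mem (by exact hy), jumpFun, if_pos hy]
        rfl
      · rw [indicator_of_notMem (by exact hy), jumpFun, if_neg hy]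
        ext p
        simp [symProd]
    have hsec : ∫ y, φ y ∂(sectionMeasure R ν x ρ) = ∫ z, φ (slab (R ν) x (0, z)) := by
      rw [sectionMeasure, integral_map (isometry_slab _ _).continuous.measurable.aemeasurable
        hφ.continuous.aestronglyMeasurable]
      refine setIntegral_eq_integral_of_forall_compl_eq_zero fun z hz => ?_
      by_contra hne
      exact hz ((slab_mem_rotCube_iff hρ z).1 (hs (subset_tsupport φ hne)))
    rw [setIntegral_eq_integral_of_forall_compl_eq_zero fun y hy => ?_]
    · simp only [hind]
      rw [integral_indicator hHm, (symProdCLM ζ).integral_comp_comm hI.restrict,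
        integral_halfSpace_gradient hφ hc (R ν) x hR,
        integral_constDensity _ _ hφ.continuous hc, hsec, map_smul, neg_smul]
      rfl
    · rw [hgrad0 y hy]
      ext p
      simp [symProd]

lemma measurable_jumpFun (x ζ : E d) (ν : Sph d) : Measurable (jumpFun x ζ ν) :=
  Measurable.ite (isOpen_lt continuous_const (by fun_prop)).measurableSet measurable_const
    measurable_const

lemma bd_jumpFun (hR : rot (R ν) (EuclideanSpace.single (Fin.last n) 1) = ν) (hρ : 0 < ρ) :
    BD (rotCube R ν x ρ) (jumpFun x ζ ν) := by
  refine ⟨?_, _, isSymGrad_jumpFun x ζ hR hρ⟩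
  refine Measure.integrableOn_of_bounded (M := ‖ζ‖) (by rw [volume_rotCube]; finiteness)
    (measurable_jumpFun x ζ ν).aestronglyMeasurable (ae_of_all _ fun y => ?_)
  rcases jumpFun_eq_or x ζ ν y with h | h <;> simp [h]

lemma acDensity_jumpFun (hR : rot (R ν) (EuclideanSpace.single (Fin.last n) 1) = ν)
    (hρ : 0 < ρ) : acDensity (rotCube R ν x ρ) (jumpFun x ζ ν) =ᵐ[volume] 0 := by
  rw [acDensity, (isSymGrad_jumpFun x ζ hR hρ).symGrad_eq (isOpen_rotCube _ _ _ _)]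
  exact density_constDensity (mutuallySingular_sectionMeasure x hR) _

/-- For `ζ ≠ 0` the measure lives on the hyperplane, whose points inside the cube are all jump
points. For `ζ = 0` the density `ζ ⊙ ν` vanishes. -/
lemma cantorPart_jumpFun (hR : rot (R ν) (EuclideanSpace.single (Fin.last n) 1) = ν)
    (hρ : 0 < ρ) : cantorPart (rotCube R ν x ρ) (jumpFun x ζ ν) = 0 := by
  have hsing : singularPart (rotCube R ν x ρ) (jumpFun x ζ ν) =
      constDensity (sectionMeasure R ν x ρ) (symProd ζ ν) := by
    rw [singularPart, (isSymGrad_jumpFun x ζ hR hρ).symGrad_eq (isOpen_rotCube _ _ _ _),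
      WithDensityᵥEq.congr_ae (acDensity_jumpFun x ζ hR hρ), withDensityᵥ_zero, sub_zero]
  rw [cantorPart, hsing]
  by_cases hm : MeasurableSet (rotCube R ν x ρ \ jumpSet (rotCube R ν x ρ) (jumpFun x ζ ν))
  · ext1 B hB
    rw [VectorMeasure.restrict_apply _ hm hB, constDensity_apply _ _ (hB.inter hm)]
    by_cases hζ : ζ = 0
    · have : symProd (0 : E (n + 1)) ν = 0 := by
        ext p
        simp [symProd]
      rw [hζ, this, smul_zero]
      rfl
    · have hnull : sectionMeasure R ν x ρ
          (B ∩ (rotCube R ν x ρ \ jumpSet (rotCube R ν x ρ) (jumpFun x ζ ν))) = 0 := by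
        refine measure_mono_null (fun y hy => ?_) (sectionMeasure_hyperplane x (ρ := ρ) hR)
        intro hyH
        exact hy.2.2 ⟨hy.2.1, _, isJump_jumpFun hζ hyH⟩
      rw [Measure.real, hnull, ENNReal.toReal_zero, zero_smul]
      rfl
  · exact VectorMeasure.restrict_not_measurable _ hm

lemma jumpSet_jumpFun_subset (hR : rot (R ν) (EuclideanSpace.single (Fin.last n) 1) = ν)
    (hρ : 0 < ρ) : jumpSet (rotCube R ν x ρ) (jumpFun x ζ ν) ⊆
      (fun z => slab (R ν) x (0, z)) '' cube (0 : E n) ρ := by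
  rintro y ⟨hyU, p, hp⟩
  have hy := inner_eq_zero_of_isJump_jumpFun hp
  obtain ⟨⟨s, z⟩, rfl⟩ := slab_surjective (R ν) x y
  rw [← hR, inner_slab_sub] at hy
  subst hy
  exact ⟨z, (slab_mem_rotCube_iff hρ z).1 hyU, rfl⟩

lemma jumpValue_jumpFun_le {g : E (n + 1) → E (n + 1) → Sph (n + 1) → ℝ} {c : ℝ} (hc : 0 ≤ c)
    (hg : ∀ x ζ ν, g x ζ ν ≤ c * ‖ζ‖) (y : E (n + 1)) :
    jumpValue g (jumpFun x ζ ν) y ≤ c * ‖ζ‖ := by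
  unfold jumpValue
  split_ifs with h
  · exact (hg _ _ _).trans
      (mul_le_mul_of_nonneg_left (norm_sub_le_of_isJump_jumpFun h.choose_spec) hc)
  · positivity

lemma energy_jumpFun_le {f : E (n + 1) → SymMat (n + 1) → ℝ}
    {g : E (n + 1) → E (n + 1) → Sph (n + 1) → ℝ} {K c : ℝ} (hf : ∀ x, f x 0 ≤ K) (hc : 0 ≤ c)
    (hg : ∀ x ζ ν, g x ζ ν ≤ c * ‖ζ‖)
    (hR : rot (R ν) (EuclideanSpace.single (Fin.last n) 1) = ν) (hρ : 0 < ρ) :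
    energy f g (jumpFun x ζ ν) (rotCube R ν x ρ) ≤
      ENNReal.ofReal K * ENNReal.ofReal ρ ^ (n + 1) +
        ENNReal.ofReal (c * ‖ζ‖) * ENNReal.ofReal ρ ^ n := by
  rw [energy, cantorPart_jumpFun x ζ hR hρ, VectorMeasure.variation_zero, Measure.restrict_zero,
    lintegral_zero_measure, add_zero]
  refine add_le_add ?_ ?_
  · rw [← volume_rotCube R ν x ρ, ← setLIntegral_const]
    refine lintegral_mono_ae (ae_restrict_of_ae ?_)
    filter_upwards [acDensity_jumpFun x ζ hR hρ] with y hy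
    rw [hy]
    exact ENNReal.ofReal_le_ofReal (hf y)
  -- The middle section is an isometric image of an `n`-dimensional cube, so its surface measure is
  -- `ρ^n`.
  · rw [← volume_cube, ← EuclideanSpace.euclideanHausdorffMeasure_eq_volume,
      ← (isometry_slab (R ν) x).euclideanHausdorffMeasure_image, ← setLIntegral_const]
    refine (lintegral_mono_set (jumpSet_jumpFun_subset x ζ hR hρ)).trans ?_
    exact lintegral_mono fun y => ENNReal.ofReal_le_ofReal (jumpValue_jumpFun_le x ζ hc hg y)

lemma eqOnBoundary_self (U : Set (E d)) (u : E d → E d) : EqOnBoundary U u u := by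
  refine ae_of_all _ fun y => ?_
  simp

lemma minValue_jumpFun_le {f : E (n + 1) → SymMat (n + 1) → ℝ}
    {g : E (n + 1) → E (n + 1) → Sph (n + 1) → ℝ} {K c : ℝ} (hf : ∀ x, f x 0 ≤ K) (hc : 0 ≤ c)
    (hg : ∀ x ζ ν, g x ζ ν ≤ c * ‖ζ‖)
    (hR : rot (R ν) (EuclideanSpace.single (Fin.last n) 1) = ν) (hρ : 0 < ρ) :
    minValue f g (jumpFun x ζ ν) (rotCube R ν x ρ) ≤
      ENNReal.ofReal K * ENNReal.ofReal ρ ^ (n + 1) +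
        ENNReal.ofReal (c * ‖ζ‖) * ENNReal.ofReal ρ ^ n :=
  iInf_le_of_le _ (iInf_le_of_le (bd_jumpFun x ζ hR hρ)
    (iInf_le_of_le (eqOnBoundary_self _ _) (energy_jumpFun_le x ζ hf hc hg hR hρ)))

end

section

variable {d n : ℕ}

/-! ### Comparison of functionals with comparable integrands -/

section Comparison

variable {f f' : E d → SymMat d → ℝ} {g g' : E d → E d → Sph d → ℝ} {a b : ℝ}

/-- The additive constant is paid only in the bulk term. The Cantor terms are equal, and `a ≥ 1`
lets the common factor multiply them too. -/
lemma energy_le_of_le (ha : 1 ≤ a) (hf : ∀ x A, f x A ≤ a * f' x A + b)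
    (hrec : recession f = recession f') (hg : ∀ x ζ ν, g x ζ ν ≤ a * g' x ζ ν)
    (u : E d → E d) (U : Set (E d)) :
    energy f g u U ≤ ENNReal.ofReal a * energy f' g' u U + ENNReal.ofReal b * volume U := by
  have ha0 : 0 ≤ a := zero_le_one.trans ha
  have h1 : ∫⁻ x in U, ENNReal.ofReal (f x (acDensity U u x)) ≤
      ENNReal.ofReal a * (∫⁻ x in U, ENNReal.ofReal (f' x (acDensity U u x))) +
        ENNReal.ofReal b * volume U := by
    rw [← lintegral_const_mul' _ _ ENNReal.ofReal_ne_top, ← setLIntegral_const,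
      ← lintegral_add_right _ measurable_const]
    refine lintegral_mono fun x => (ENNReal.ofReal_le_ofReal (hf _ _)).trans ?_
    rw [← ENNReal.ofReal_mul ha0]
    exact ENNReal.ofReal_add_le
  have h2 : ∫⁻ x in U, ENNReal.ofReal
      (recession f x (density (cantorPart U u) (cantorPart U u).variation x))
        ∂(cantorPart U u).variation ≤
      ENNReal.ofReal a * ∫⁻ x in U, ENNReal.ofReal
        (recession f' x (density (cantorPart U u) (cantorPart U u).variation x))
          ∂(cantorPart U u).variation := by
    rw [hrec]
    exact le_mul_of_one_le_left' (ENNReal.one_le_ofReal.2 ha)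
  have h3 : ∫⁻ x in jumpSet U u, ENNReal.ofReal (jumpValue g u x)
        ∂(Measure.euclideanHausdorffMeasure (d - 1) : Measure (E d)) ≤
      ENNReal.ofReal a * ∫⁻ x in jumpSet U u, ENNReal.ofReal (jumpValue g' u x)
        ∂(Measure.euclideanHausdorffMeasure (d - 1) : Measure (E d)) := by
    rw [← lintegral_const_mul' _ _ ENNReal.ofReal_ne_top]
    refine lintegral_mono fun x => ?_
    rw [← ENNReal.ofReal_mul ha0]
    refine ENNReal.ofReal_le_ofReal ?_
    unfold jumpValue
    split_ifs with h
    · exact hg _ _ _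
    · simp
  rw [energy, energy, mul_add, mul_add]
  refine (add_le_add (add_le_add h1 h2) h3).trans_eq ?_
  ring

lemma minValue_le_of_le (ha : 1 ≤ a) (hf : ∀ x A, f x A ≤ a * f' x A + b)
    (hrec : recession f = recession f') (hg : ∀ x ζ ν, g x ζ ν ≤ a * g' x ζ ν)
    (v : E d → E d) (U : Set (E d)) :
    minValue f g v U ≤ ENNReal.ofReal a * minValue f' g' v U + ENNReal.ofReal b * volume U := by
  have ha0 : ENNReal.ofReal a ≠ 0 := (ENNReal.ofReal_pos.2 (zero_lt_one.trans_le ha)).ne'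
  simp only [minValue, ENNReal.mul_iInf_of_ne ha0 ENNReal.ofReal_ne_top, ENNReal.iInf_add]
  exact le_iInf fun u => le_iInf fun hu => le_iInf fun hb => iInf_le_of_le u
    (iInf_le_of_le hu (iInf_le_of_le hb (energy_le_of_le ha hf hrec hg u U)))

end Comparison

lemma toReal_sub_le_of_le {M N : ℝ≥0∞} {a b B V : ℝ} (hN : N ≠ ⊤) (ha : 0 ≤ a) (hb : 0 ≤ b)
    (hV : 0 ≤ V) (hNB : N.toReal ≤ B)
    (h : M ≤ ENNReal.ofReal (1 + a) * N + ENNReal.ofReal b * ENNReal.ofReal V) :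
    M.toReal - N.toReal ≤ a * B + b * V := by
  have h1 := ENNReal.toReal_mono (by finiteness) h
  rw [ENNReal.toReal_add (by finiteness) (by finiteness), ENNReal.toReal_mul, ENNReal.toReal_mul,
    ENNReal.toReal_ofReal (by linarith), ENNReal.toReal_ofReal hb,
    ENNReal.toReal_ofReal hV] at h1
  nlinarith [mul_le_mul_of_nonneg_left hNB ha]

lemma ne_top_and_toReal_le {M : ℝ≥0∞} {K c ρ : ℝ} (hK : 0 ≤ K) (hc : 0 ≤ c) (hρ : 0 ≤ ρ)
    (hρ₁ : ρ ≤ 1) (h : M ≤ ENNReal.ofReal K * ENNReal.ofReal ρ ^ (n + 1) +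
      ENNReal.ofReal c * ENNReal.ofReal ρ ^ n) : M ≠ ⊤ ∧ M.toReal ≤ (K + c) * ρ ^ n := by
  have hle : ρ ^ (n + 1) ≤ ρ ^ n := pow_le_pow_of_le_one hρ hρ₁ n.le_succ
  have h' : M ≤ ENNReal.ofReal ((K + c) * ρ ^ n) := by
    refine h.trans ?_
    rw [← ENNReal.ofReal_pow hρ, ← ENNReal.ofReal_pow hρ, ← ENNReal.ofReal_mul hK,
      ← ENNReal.ofReal_mul hc, ← ENNReal.ofReal_add (by positivity) (by positivity), add_mul]
    gcongr
  exact ⟨ne_top_of_le_ne_top ENNReal.ofReal_ne_top h',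
    ENNReal.toReal_le_of_le_ofReal (by positivity) h'⟩

/-- The arithmetic of the error terms: a bound for small rates, and a trivial bound otherwise. -/
lemma abs_sub_le_of_rates {m k K c₆ c₇ P q ε : ℝ} (hm : 0 ≤ m) (hk : 0 ≤ k) (hP : 0 ≤ P)
    (hq : 0 ≤ q) (hε : 0 ≤ ε) (hK : 0 ≤ K) (hc₆ : 0 ≤ c₆) (hc₇ : 0 ≤ c₇) (hmK : m ≤ K * P)
    (hkK : k ≤ K * P) (h : 2 * (c₆ * q) ≤ 1 → 2 * (c₇ * ε) ≤ 1 →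
      |m - k| ≤ (2 * (c₆ * q) + 4 * (c₇ * ε)) * (K * P) + 4 * c₆ * (P * q)) :
    |m - k| ≤ ((2 * c₆ + 4 * c₇) * K + 4 * c₆ + 1) * (P * q) +
      ((2 * c₆ + 4 * c₇) * K + 4 * c₆ + 1) * ε * P := by
  have htriv : |m - k| ≤ K * P := abs_sub_le_of_nonneg_of_le hm hmK hk hkK
  have hKP : 0 ≤ K * P := by positivity
  have e1 : 0 ≤ c₇ * K * (P * q) := by positivity
  have e2 : 0 ≤ c₆ * K * (ε * P) := by positivity
  have e3 : 0 ≤ c₆ * (ε * P) := by positivity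
  have e4 : 0 ≤ P * q := by positivity
  have e5 : 0 ≤ ε * P := by positivity
  have e6 : 0 ≤ c₆ * (P * q) := by positivity
  have e7 : 0 ≤ c₇ * K * (ε * P) := by positivity
  have e8 : 0 ≤ c₆ * K * (P * q) := by positivity
  -- If a rate exceeds the threshold, multiplying the trivial bound `K * P` by `2 c₆ q > 1` or `2 c₇
  -- ε > 1` already gives an admissible error.
  by_cases h1 : 2 * (c₆ * q) ≤ 1
  · by_cases h2 : 2 * (c₇ * ε) ≤ 1
    · have := h h1 h2
      linarith
    · have := mul_le_mul_of_nonneg_right (not_le.1 h2).le hKP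
      linarith
  · have := mul_le_mul_of_nonneg_right (not_le.1 h1).le hKP
    linarith

/-! ### Two-sided comparison of the rescaled and the limit functional -/

section Rates

variable {α c₁ c₂ c₃ c₄ c₅ c₆ c₇ ε ρ : ℝ} {σ : ℝ → ℝ} {f : E d → SymMat d → ℝ}
  {g : E d → E d → Sph d → ℝ}

lemma minValue_scaled_le_and_ge (hα₀ : 0 < α) (hα₁ : α < 1) (hc₃ : 0 ≤ c₃) (hc₄ : 0 ≤ c₄)
    (hc₆ : 0 ≤ c₆) (hc₇ : 0 ≤ c₇) (hf : IsBulkAlpha c₁ c₂ c₃ c₄ c₅ c₆ α f)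
    (hg : IsSurfInfty c₁ c₃ c₇ σ g) (hε : 0 < ε) (hρ : 0 < ρ) (hρ₁ : ρ ≤ 1)
    (h₆ : 2 * (c₆ * ρ ^ α) ≤ 1) (h₇ : 2 * (c₇ * ε) ≤ 1) (v : E d → E d) (U : Set (E d)) :
    minValue (scaledBulk ε f) (scaledSurf ε g) v U ≤
      ENNReal.ofReal (1 + (2 * (c₆ * ρ ^ α) + 4 * (c₇ * ε))) *
        minValue (fun x => recession f (ε⁻¹ • x)) (fun x => surfRecession g (ε⁻¹ • x)) v U +
          ENNReal.ofReal (4 * c₆ * ρ ^ (α - 1)) * volume U ∧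
    minValue (fun x => recession f (ε⁻¹ • x)) (fun x => surfRecession g (ε⁻¹ • x)) v U ≤
      ENNReal.ofReal (1 + (2 * (c₆ * ρ ^ α) + 4 * (c₇ * ε))) *
        minValue (scaledBulk ε f) (scaledSurf ε g) v U +
          ENNReal.ofReal (4 * c₆ * ρ ^ (α - 1)) * volume U := by
  have hρα : 0 ≤ ρ ^ α := Real.rpow_nonneg hρ.le _
  have ha : 1 ≤ 1 + (2 * (c₆ * ρ ^ α) + 4 * (c₇ * ε)) := by
    have : 0 ≤ 2 * (c₆ * ρ ^ α) + 4 * (c₇ * ε) := by positivity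
    linarith
  have hrec : recession (scaledBulk ε f) = recession fun x => recession f (ε⁻¹ • x) :=
    (recession_eq_of_smul (h := fun x => recession f (ε⁻¹ • x)) fun x A s hs =>
      hf.recession_smul hα₀ hα₁ hc₃ hc₄ _ A hs).symm
  have hcε : 0 ≤ c₇ * ε := by positivity
  have hcρ : 0 ≤ c₆ * ρ ^ α := by positivity
  refine ⟨minValue_le_of_le ha (fun x A => ?_) hrec (fun x ζ ν => ?_) v U,
    minValue_le_of_le ha (fun x A => ?_) hrec.symm (fun x ζ ν => ?_) v U⟩
  · have h1 := hf.bulk_le hα₀ hα₁ hc₃ hc₄ hc₆ hρ hρ₁ h₆ (ε⁻¹ • x) A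
    have h2 := mul_nonneg hcε (hf.recession_nonneg hα₀ hα₁ hc₃ hc₄ (ε⁻¹ • x) A)
    unfold scaledBulk
    linarith
  · have h0 := hg.surfRecession_nonneg hc₃ hc₇ (ε⁻¹ • x) ζ ν
    have h1 := le_of_abs_sub_le h0 hcε h₇ (hg.abs_sub_surfRecession_le hc₃ hc₇ (ε⁻¹ • x) ζ ν hε)
    have h2 := mul_nonneg hcρ h0
    unfold scaledSurf
    linarith
  · have h1 := hf.recession_le hα₀ hα₁ hc₃ hc₄ hc₆ hρ hρ₁ (ε⁻¹ • x) A
    have h2 := mul_nonneg hcε (hf.nonneg (ε⁻¹ • x) A)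
    unfold scaledBulk
    linarith
  · have h0 := mul_nonneg hε.le (hg.nonneg (ε⁻¹ • x) (ε⁻¹ • ζ) ν)
    have h1 := hg.abs_sub_surfRecession_le hc₃ hc₇ (ε⁻¹ • x) ζ ν hε
    rw [abs_sub_comm, add_comm (ε * _)] at h1
    have h1 := le_of_abs_sub_le h0 hcε h₇ h1
    have h2 := mul_nonneg hcρ h0
    unfold scaledSurf
    linarith

end Rates

end

end BDCubes

end

theorem mainTheorem8 (α c₃ c₆ c₇ r : ℝ) (hα₀ : 0 < α) (hα₁ : α < 1) (hc₃ : 0 < c₃)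
    (hc₆ : 0 ≤ c₆) (hc₇ : 0 ≤ c₇) (hr : 0 ≤ r) :
    ∃ C : ℝ, 0 < C ∧
      ∀ (d : ℕ) (R : Sph d → Matrix.specialOrthogonalGroup (Fin d) ℝ), IsFrame R →
      ∀ (c₁ c₂ c₄ c₅ σ₁ : ℝ), 0 < c₁ → c₁ ≤ c₃ → 0 ≤ c₂ → 0 ≤ c₄ → 0 ≤ c₅ → 0 < σ₁ →
      ∀ (f : E d → SymMat d → ℝ) (g : E d → E d → Sph d → ℝ),
        IsBulkAlpha c₁ c₂ c₃ c₄ c₅ c₆ α f →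
        IsSurfInfty c₁ c₃ c₇ (fun τ => σ₁ * τ) g →
      ∀ (ε ρ : ℝ) (x ζ : E d) (ν : Sph d),
        0 < ε → 2 * c₆ * ε < 1 → 0 < ρ → ρ < 1 → ‖ζ‖ = r →
        minValue (scaledBulk ε f) (scaledSurf ε g) (jumpFun x ζ ν) (rotCube R ν x ρ) ≠ ⊤ ∧
        minValue (recession f) (surfRecession g) (jumpFun (ε⁻¹ • x) ζ ν)
          (rotCube R ν (ε⁻¹ • x) (ρ / ε)) ≠ ⊤ ∧
        |(minValue (scaledBulk ε f) (scaledSurf ε g) (jumpFun x ζ ν)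
              (rotCube R ν x ρ)).toReal -
            ε ^ (d - 1) * (minValue (recession f) (surfRecession g) (jumpFun (ε⁻¹ • x) ζ ν)
              (rotCube R ν (ε⁻¹ • x) (ρ / ε))).toReal| ≤
          C * ρ ^ ((d : ℝ) - 1 + α) + C * ε * ρ ^ (d - 1) := by
  obtain ⟨K₀, hK₀, hK₀f⟩ := exists_bulk_zero_le α c₆ hα₀ hα₁ hc₆
  have hcr : 0 ≤ c₃ * r := by positivity
  refine ⟨(2 * c₆ + 4 * c₇) * (K₀ + c₃ * r) + 4 * c₆ + 1, by positivity, ?_⟩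
  intro d R hR c₁ c₂ c₄ c₅ σ₁ _ _ _ hc₄ _ _ f g hf hg ε ρ x ζ ν hε _ hρ hρ₁ hζ
  -- In dimension 0 there are no unit vectors.
  obtain ⟨n, rfl⟩ : ∃ n, d = n + 1 := by
    refine Nat.exists_eq_succ_of_ne_zero ?_
    rintro rfl
    have h1 : ‖(ν : E 0)‖ = 1 := norm_eq_of_mem_sphere ν
    rw [Subsingleton.elim (ν : E 0) 0, norm_zero] at h1
    exact zero_ne_one h1
  have hRν := hR.map_last ν (Fin.last n) rfl
  have hε' : 0 < ε⁻¹ := inv_pos.2 hε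
  set M := minValue (scaledBulk ε f) (scaledSurf ε g) (jumpFun x ζ ν) (rotCube R ν x ρ)
  -- The limit problem pulled back to the original cube: it has the same competitors as `M`, and
  -- `hscale` accounts for the factor `ε^(d-1)`.
  set N := minValue (fun x => recession f (ε⁻¹ • x)) (fun x => surfRecession g (ε⁻¹ • x))
    (jumpFun x ζ ν) (rotCube R ν x ρ)
  have hscale : minValue (recession f) (surfRecession g) (jumpFun (ε⁻¹ • x) ζ ν)
      (rotCube R ν (ε⁻¹ • x) (ρ / ε)) = ENNReal.ofReal (ε⁻¹ ^ n) * N := by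
    have h := minValue_dilation hε' (f := recession f)
      (fun x A s hs => hf.recession_smul hα₀ hα₁ hc₃.le hc₄ x A hs) (surfRecession g)
      (isOpen_rotCube R ν x ρ) (jumpFun x ζ ν) n.succ_pos
    rwa [jumpFun_dilation, rotCube_dilation, inv_mul_eq_div] at h
  obtain ⟨hMtop, hMle⟩ := ne_top_and_toReal_le hK₀ hcr hρ.le hρ₁.le
    (hζ ▸ minValue_jumpFun_le x ζ (f := scaledBulk ε f) (g := scaledSurf ε g) (c := c₃)
      (fun y => hK₀f _ _ _ _ _ _ hc₃.le hc₄ f hf (ε⁻¹ • y)) hc₃.le (fun y ξ μ => by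
        have h := mul_le_mul_of_nonneg_left (hg.toIsSurf.le_norm hc₃.le (ε⁻¹ • y) (ε⁻¹ • ξ) μ)
          hε.le
        refine h.trans_eq ?_
        rw [norm_smul, Real.norm_of_nonneg hε'.le]
        field_simp) hRν hρ)
  obtain ⟨hNtop, hNle⟩ := ne_top_and_toReal_le hK₀ hcr hρ.le hρ₁.le
    (hζ ▸ minValue_jumpFun_le x ζ (f := fun x => recession f (ε⁻¹ • x))
      (g := fun x => surfRecession g (ε⁻¹ • x)) (c := c₃)
      (fun y => (hf.recession_zero hα₀ hα₁ hc₃.le hc₄ (ε⁻¹ • y)).trans_le hK₀) hc₃.le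
      (fun y ξ μ => hg.surfRecession_le hc₃.le hc₇ _ ξ μ) hRν hρ)
  have hρα : 0 ≤ ρ ^ (α - 1) := Real.rpow_nonneg hρ.le _
  -- The additive bulk error times the volume of the cube has the order `ρ^(d-1+α)`.
  have hpow : ρ ^ (α - 1) * ρ ^ (n + 1) = ρ ^ n * ρ ^ α := by
    rw [Real.rpow_sub_one hρ.ne', pow_succ']
    field_simp
  have hpow' : ρ ^ (((n + 1 : ℕ) : ℝ) - 1 + α) = ρ ^ n * ρ ^ α := by
    rw [Real.rpow_add hρ, ← Real.rpow_natCast]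
    simp
  have hNeq : ε ^ n * (ENNReal.ofReal (ε⁻¹ ^ n) * N).toReal = N.toReal := by
    rw [ENNReal.toReal_mul, ENNReal.toReal_ofReal (by positivity), ← mul_assoc, ← mul_pow,
      mul_inv_cancel₀ hε.ne', one_pow, one_mul]
  refine ⟨hMtop, by rw [hscale]; finiteness, ?_⟩
  rw [hscale, Nat.add_sub_cancel, hNeq, hpow']
  refine abs_sub_le_of_rates ENNReal.toReal_nonneg ENNReal.toReal_nonneg (by positivity)
    (Real.rpow_nonneg hρ.le _) hε.le (by positivity) hc₆ hc₇ hMle hNle fun h₆ h₇ => ?_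
  have hρα' : 0 ≤ ρ ^ α := Real.rpow_nonneg hρ.le _
  obtain ⟨h1, h2⟩ := minValue_scaled_le_and_ge hα₀ hα₁ hc₃.le hc₄ hc₆ hc₇ hf hg hε hρ hρ₁.le
    h₆ h₇ (jumpFun x ζ ν) (rotCube R ν x ρ)
  rw [volume_rotCube, ← ENNReal.ofReal_pow hρ.le] at h1 h2
  have h3 := toReal_sub_le_of_le hNtop (by positivity) (by positivity) (by positivity) hNle h1
  have h4 := toReal_sub_le_of_le hMtop (by positivity) (by positivity) (by positivity) hMle h2
  rw [mul_assoc (4 * c₆), hpow] at h3 h4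
  exact abs_sub_le_iff.2 ⟨h3, h4⟩
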